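/- An instance $(G,I,\sigma)$ of the connector enumeration problem consists of a finite undirected graph $G$ (multiple edges allowed, no self-loops) with $n=|V(G)|\ge 1$ vertices and $m=|E(G)|$ edges, a set $I$ of $q=|I|\ge 1$ items, and a function $\sigma:V(G)\to 2^I$. For $X\subseteq V(G)$ let $I_\sigma(X)=\bigcap_{u\in X}\sigma(u)$, and let $G[X]$ be the subgraph induced by $X$, where $G[\emptyset]$ is regarded as disconnected. A set $X\subseteq V(G)$ is a connector if $G[X]$ is connected and, for every vertex $v\in V(G)\setminus X$, $G[X\cup\{v\}]$ is not connected or $I_\sigma(X\cup\{v\})\subsetneq I_\sigma(X)$; that is, no proper superset $Y$ of $X$ has $G[Y]$ connected and $I_\sigma(Y)=I_\sigma(X)$. Theorem. There is an algorithm that, given an instance $(G,I,\sigma)$ (with $G$ given by adjacency lists and $\sigma$ by an $n\times q$ bit matrix), outputs all connectors, each exactly once, with $O(q^2(n+m)n)$ delay and in $O((q+n+m)n)$ space. Here the algorithm runs on a unit-cost random access machine with words of $O(\log(n+m+q))$ bits, space is counted in words and includes the input, and the delay bounds the time before the first output, the time between any two consecutive outputs, and the time after the last output. -/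

import Mathlib

namespace ConnectorEnum

/-! ### Instances and connectors -/

/-- An instance `(G, I, σ)`: an undirected graph `G` on the vertex set `{0, …, n - 1}` with `m`
edges (parallel edges are allowed, self-loops are not), the item set `I = {0, …, q - 1}`, and the
item set `σ v ⊆ I` of every vertex `v`. -/
structure Instance (n m q : ℕ) where
  /-- the two end-vertices of an edge -/
  ends : Fin m → Sym2 (Fin n)
  /-- no edge is a self-loop -/
  loopless : ∀ e, ¬ (ends e).IsDiag
  /-- the items of a vertex -/
  σ : Fin n → Finset (Fin q)

namespace Instance

variable {n m q : ℕ}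

/-- The adjacency relation of `G`: two vertices are adjacent if some edge joins them. -/
def graph (A : Instance n m q) : SimpleGraph (Fin n) where
  Adj u v := ∃ e, A.ends e = s(u, v)
  symm := ⟨fun _ _ h => h.imp fun _ he => he.trans Sym2.eq_swap⟩
  loopless := ⟨fun _ h => h.elim fun e he => A.loopless e (by rw [he]; exact rfl)⟩

/-- `G[X]` is connected (in particular `X` is non-empty). -/
def InducesConnected (A : Instance n m q) (X : Finset (Fin n)) : Prop :=
  (A.graph.induce (X : Set (Fin n))).Connected

/-- The common item set `I_σ(X) = ⋂ v ∈ X, σ v`. -/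
def commonItems (A : Instance n m q) (X : Finset (Fin n)) : Finset (Fin q) :=
  Finset.univ.filter fun i => ∀ v ∈ X, i ∈ A.σ v

/-- `X` is a connector: `G[X]` is connected, and for every vertex `v` outside of `X`, the graph
`G[X ∪ {v}]` is not connected or `I_σ(X ∪ {v})` is a proper subset of `I_σ(X)`. -/
def IsConnector (A : Instance n m q) (X : Finset (Fin n)) : Prop :=
  A.InducesConnected X ∧
    ∀ v, v ∉ X → ¬ A.InducesConnected (insert v X) ∨ A.commonItems (insert v X) ⊂ A.commonItems X

/-! ### The input of the machine -/

/-- `adj` is an adjacency-list representation of `G`: the list of `u` holds, in any order, one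
entry `v` for every edge that joins `u` and `v`. -/
def IsAdjacencyList (A : Instance n m q) (adj : Fin n → List (Fin n)) : Prop :=
  ∀ u v, (adj u).count v = (Finset.univ.filter fun e => A.ends e = s(u, v)).card

/-- The words of the input: the three numbers `n, m, q`; the `n + 1` offsets of the adjacency
lists (the entries of the list of `u` are those with indices from the `u`-th offset up to, but not
including, the `(u + 1)`-st one); the concatenated adjacency lists, `2 * m` words in all; and the
`n * q` bits `[i ∈ σ v]`, vertex by vertex. -/
def inputWords (A : Instance n m q) (adj : Fin n → List (Fin n)) : List ℕ :=
  [n, m, q] ++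
    (List.range (n + 1)).map
      (fun k => (((List.finRange n).take k).map fun v => (adj v).length).sum) ++
    (List.finRange n).flatMap (fun v => (adj v).map fun w => (w : ℕ)) ++
    (List.finRange n).flatMap (fun v => (List.finRange q).map fun i => if i ∈ A.σ v then 1 else 0)

end Instance

/-! ### The machine: a unit-cost word RAM with structured programs -/

/-- The binary word operations: sum, truncated difference, product, and the tests `<` and `=`
(with value `1` or `0`). -/
inductive Op
  | plus | minus | times | less | equal

/-- The value of a word operation. -/
def Op.eval : Op → ℕ → ℕ → ℕ
  | .plus, a, b => a + b
  | .minus, a, b => a - b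
  | .times, a, b => a * b
  | .less, a, b => if a < b then 1 else 0
  | .equal, a, b => if a = b then 1 else 0

/-- Expressions: constants, registers, memory cells (indirect addressing), word operations. -/
inductive Expr
  | const (k : ℕ)
  | reg (x : ℕ)
  | load (a : Expr)
  | bin (o : Op) (a b : Expr)

/-- Programs. A program mentions finitely many registers, and works on a random access memory. -/
inductive Cmd
  | skip
  /-- put the value of `e` into register `x` -/
  | assign (x : ℕ) (e : Expr)
  /-- put the value of `e` into the memory cell whose address is the value of `a` -/
  | store (a e : Expr)
  | seq (c d : Cmd)
  /-- branch on whether the value of `e` is non-zero -/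
  | ite (e : Expr) (c d : Cmd)
  /-- repeat `c` as long as the value of `e` is non-zero -/
  | loop (e : Expr) (c : Cmd)
  /-- append the value of `e` to the piece of output that is being written -/
  | write (e : Expr)
  /-- complete the piece of output that is being written -/
  | emit

/-- A state of the machine. The last three components only observe the run: no expression reads
them. -/
structure State where
  /-- the registers -/
  regs : ℕ → ℕ
  /-- the memory -/
  mem : ℕ → ℕ
  /-- the number of steps made so far -/
  clock : ℕ
  /-- the piece of output that is being written -/
  buf : List ℕ
  /-- the completed pieces of output, in order, each with the time of its completion -/
  outs : List (ℕ × List ℕ)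

/-- The value of an expression. -/
def Expr.eval (s : State) : Expr → ℕ
  | .const k => k
  | .reg x => s.regs x
  | .load a => s.mem (a.eval s)
  | .bin o a b => o.eval (a.eval s) (b.eval s)

/-- The number of steps that the evaluation of an expression takes: one for every node. -/
def Expr.cost : Expr → ℕ
  | .const _ => 1
  | .reg _ => 1
  | .load a => a.cost + 1
  | .bin _ a b => a.cost + b.cost + 1

/-- The evaluation of an expression respects the limits of a machine with memory cells
`0, …, S - 1` whose words are the numbers less than `W`: every cell that is read has an address
less than `S`, and every value that occurs is less than `W`. -/
def Expr.Fits (S W : ℕ) (s : State) : Expr → Prop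
  | .const k => k < W
  | .reg x => s.regs x < W
  | .load a => a.Fits S W s ∧ a.eval s < S ∧ s.mem (a.eval s) < W
  | .bin o a b => a.Fits S W s ∧ b.Fits S W s ∧ o.eval (a.eval s) (b.eval s) < W

/-- Let `k` steps pass. -/
def State.tick (s : State) (k : ℕ) : State := { s with clock := s.clock + k }

/-- `Exec S W c s t`: on a machine with memory cells `0, …, S - 1` whose words are the numbers less
than `W`, the program `c`, started in state `s`, halts in state `t`. A run that would exceed the
memory or overflow a word is stuck, so that it does not halt. -/
inductive Exec (S W : ℕ) : Cmd → State → State → Prop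
  | skip (s : State) : Exec S W .skip s (s.tick 1)
  | assign (x : ℕ) (e : Expr) (s : State) (he : e.Fits S W s) :
      Exec S W (.assign x e) s
        ({ s with regs := Function.update s.regs x (e.eval s) }.tick (e.cost + 1))
  | store (a e : Expr) (s : State) (ha : a.Fits S W s) (he : e.Fits S W s) (hS : a.eval s < S) :
      Exec S W (.store a e) s
        ({ s with mem := Function.update s.mem (a.eval s) (e.eval s) }.tick (a.cost + e.cost + 1))
  | seq {c d : Cmd} {s t u : State} (hc : Exec S W c s t) (hd : Exec S W d t u) :
      Exec S W (.seq c d) s u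
  | ite_true {e : Expr} {c d : Cmd} {s t : State} (he : e.Fits S W s) (h : e.eval s ≠ 0)
      (hc : Exec S W c (s.tick (e.cost + 1)) t) : Exec S W (.ite e c d) s t
  | ite_false {e : Expr} {c d : Cmd} {s t : State} (he : e.Fits S W s) (h : e.eval s = 0)
      (hd : Exec S W d (s.tick (e.cost + 1)) t) : Exec S W (.ite e c d) s t
  | loop_true {e : Expr} {c : Cmd} {s t u : State} (he : e.Fits S W s) (h : e.eval s ≠ 0)
      (hc : Exec S W c (s.tick (e.cost + 1)) t) (hl : Exec S W (.loop e c) t u) :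
      Exec S W (.loop e c) s u
  | loop_false {e : Expr} {c : Cmd} {s : State} (he : e.Fits S W s) (h : e.eval s = 0) :
      Exec S W (.loop e c) s (s.tick (e.cost + 1))
  | write (e : Expr) (s : State) (he : e.Fits S W s) :
      Exec S W (.write e) s ({ s with buf := s.buf ++ [e.eval s] }.tick (e.cost + 1))
  | emit (s : State) :
      Exec S W .emit s { s with
        clock := s.clock + 1
        buf := []
        outs := s.outs ++ [(s.clock + 1, s.buf)] }

/-- The initial state: the input stands at the beginning of the memory, and everything else is
zero or empty. -/
def initialState (input : List ℕ) : State where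
  regs := fun _ => 0
  mem := fun a => input.getD a 0
  clock := 0
  buf := []
  outs := []

/-! ### What a run has to achieve -/

/-- The word list `l` lists the vertices of `X`, each of them once, in any order. -/
def IsListing {n : ℕ} (X : Finset (Fin n)) (l : List ℕ) : Prop :=
  l.Nodup ∧ ∀ a, a ∈ l ↔ ∃ v ∈ X, (v : ℕ) = a

/-- The output of a halted run consists of the sets with property `P`, each of them exactly once. -/
def Enumerates {n : ℕ} (P : Finset (Fin n) → Prop) (t : State) : Prop :=
  t.buf = [] ∧ ∃ Xs : List (Finset (Fin n)), Xs.Nodup ∧ (∀ X, X ∈ Xs ↔ P X) ∧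
    List.Forall₂ IsListing Xs (t.outs.map Prod.snd)

/-- The delay of a halted run is at most `D`: the time up to the first output (preprocessing), the
time between any two consecutive outputs, and the time from the last output to the end of the run
(postprocessing) are all at most `D`. -/
def DelayAtMost (D : ℕ) (t : State) : Prop :=
  List.IsChain (fun a b => b ≤ a + D) (0 :: (t.outs.map Prod.fst ++ [t.clock]))

end ConnectorEnum

/-!
The connectors `X` with a prescribed set `J` of common items are among the components of the
subgraph on `{v | J ⊆ σ v}`: a connected set whose vertices have all items of `J` lies in one such
component, and a component `K` is always a connector, since a vertex that is adjacent to `K` but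
outside of it lacks an item of `J` (`IsLabelling.isConnector_fiber`). So the connectors with
`I_σ(X) = J` are the components with no further common item (`IsLabelling.isConnector_iff`).

Prefixes of the bit string of `I_σ(X)` are therefore easy to test. Let `J` be the set of the items
below `i` that a prefix of length `i` selects. Some connector has common items with this prefix if
and only if some component for `J` has no common item below `i` outside of `J`
(`IsLabelling.exists_isConnector_iff`). The algorithm is a depth-first search through the binary
tree of prefixes that turns back at every prefix without a connector below it. At a complete prefix
it outputs the components that pass the test. Each connector is output once, at the leaf that
spells its own common item set.

One test costs `O(q (n + m) n)`: the components are found by label propagation, in `n` rounds that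
each scan all adjacency lists (`runs_propagate`), after which every vertex is labelled with the
smallest vertex of its component, and the test of one component reads the item bits once
(`runs_testRoot`). Every visited prefix with a connector below it has a child with one, so the
search makes `O(q)` tests between consecutive outputs, before the first and after the last
(`leads_subtree`). The memory holds the input, one prefix and one label per vertex, and no stack:
the path from the root is the current prefix itself.

Programs are verified by a Hoare-style calculus with explicit time bounds: `Runs` for parts without
output, and `Reaches` in general, where the predicate `Lag` keeps the account of the delay.
-/

namespace ConnectorEnum

/-! ### Reasoning about runs of the machine -/

/-- The value of an expression, as a function of the registers `r` and the memory `μ`. -/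
def Expr.val (r μ : ℕ → ℕ) : Expr → ℕ
  | .const k => k
  | .reg x => r x
  | .load a => μ (a.val r μ)
  | .bin o a b => o.eval (a.val r μ) (b.val r μ)

/-- `Expr.Fits`, as a property of the registers `r` and the memory `μ`. -/
def Expr.Ok (S W : ℕ) (r μ : ℕ → ℕ) : Expr → Prop
  | .const k => k < W
  | .reg x => r x < W
  | .load a => a.Ok S W r μ ∧ a.val r μ < S ∧ μ (a.val r μ) < W
  | .bin o a b => a.Ok S W r μ ∧ b.Ok S W r μ ∧ o.eval (a.val r μ) (b.val r μ) < W

theorem Expr.eval_eq (s : State) (e : Expr) : e.eval s = e.val s.regs s.mem := by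
  induction e with
  | const k => rfl
  | reg x => rfl
  | load a ih => simp [Expr.eval, Expr.val, ih]
  | bin o a b iha ihb => simp [Expr.eval, Expr.val, iha, ihb]

theorem Expr.fits_iff (S W : ℕ) (s : State) (e : Expr) :
    e.Fits S W s ↔ e.Ok S W s.regs s.mem := by
  induction e with
  | const k => rfl
  | reg x => rfl
  | load a ih => simp [Expr.Fits, Expr.Ok, ih, Expr.eval_eq]
  | bin o a b iha ihb => simp [Expr.Fits, Expr.Ok, iha, ihb, Expr.eval_eq]

/-- Some run of `c` from `s` halts in a state with property `Q`. -/
def Reaches (S W : ℕ) (c : Cmd) (s : State) (Q : State → Prop) : Prop :=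
  ∃ t, Exec S W c s t ∧ Q t

/-- A total-correctness judgement for commands that produce no output: `c`, started in `s`, halts
within `T` steps, leaves the output alone, and makes `Q` true of the registers and the memory. -/
def Runs (S W : ℕ) (c : Cmd) (s : State) (T : ℕ) (Q : (ℕ → ℕ) → (ℕ → ℕ) → Prop) : Prop :=
  Reaches S W c s fun t =>
    t.clock ≤ s.clock + T ∧ t.buf = s.buf ∧ t.outs = s.outs ∧ Q t.regs t.mem

variable {S W : ℕ} {c d : Cmd} {s t : State} {T T' : ℕ} {Q Q' : (ℕ → ℕ) → (ℕ → ℕ) → Prop}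

theorem Reaches.mono {P P' : State → Prop} (h : Reaches S W c s P) (hP : ∀ t, P t → P' t) :
    Reaches S W c s P' :=
  h.imp fun t ht => ⟨ht.1, hP t ht.2⟩

theorem Reaches.seq {P : State → Prop} (h : Reaches S W c s fun t => Reaches S W d t P) :
    Reaches S W (.seq c d) s P := by
  obtain ⟨t, ht, u, hu, hP⟩ := h
  exact ⟨u, .seq ht hu, hP⟩

theorem Reaches.ite {P : State → Prop} {e : Expr} (he : e.Ok S W s.regs s.mem)
    (h1 : e.val s.regs s.mem ≠ 0 → Reaches S W c (s.tick (e.cost + 1)) P)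
    (h0 : e.val s.regs s.mem = 0 → Reaches S W d (s.tick (e.cost + 1)) P) :
    Reaches S W (.ite e c d) s P := by
  rw [← Expr.fits_iff] at he
  rw [← Expr.eval_eq] at h1 h0
  by_cases h : e.eval s = 0
  · obtain ⟨t, ht, hP⟩ := h0 h
    exact ⟨t, .ite_false he h ht, hP⟩
  · obtain ⟨t, ht, hP⟩ := h1 h
    exact ⟨t, .ite_true he h ht, hP⟩

theorem Runs.mono (h : Runs S W c s T Q) (hT : T ≤ T') (hQ : ∀ r μ, Q r μ → Q' r μ) :
    Runs S W c s T' Q' :=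
  Reaches.mono h fun _ ht => ⟨by omega, ht.2.1, ht.2.2.1, hQ _ _ ht.2.2.2⟩

theorem Runs.skip (hQ : Q s.regs s.mem) : Runs S W .skip s 1 Q :=
  ⟨_, .skip s, le_rfl, rfl, rfl, hQ⟩

theorem Runs.assign {x : ℕ} {e : Expr} (he : e.Ok S W s.regs s.mem)
    (hQ : Q (Function.update s.regs x (e.val s.regs s.mem)) s.mem) :
    Runs S W (.assign x e) s (e.cost + 1) Q :=
  ⟨_, .assign x e s ((Expr.fits_iff ..).2 he), le_rfl, rfl, rfl, by
    simpa [State.tick, Expr.eval_eq] using hQ⟩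

theorem Runs.store {a e : Expr} (ha : a.Ok S W s.regs s.mem) (he : e.Ok S W s.regs s.mem)
    (hS : a.val s.regs s.mem < S)
    (hQ : Q s.regs (Function.update s.mem (a.val s.regs s.mem) (e.val s.regs s.mem))) :
    Runs S W (.store a e) s (a.cost + e.cost + 1) Q :=
  ⟨_, .store a e s ((Expr.fits_iff ..).2 ha) ((Expr.fits_iff ..).2 he)
    (by rwa [Expr.eval_eq]), le_rfl, rfl, rfl, by simpa [State.tick, Expr.eval_eq] using hQ⟩

theorem Runs.seq
    (h : Runs S W c s T fun r μ => ∀ t : State, t.regs = r → t.mem = μ → Runs S W d t T' Q) :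
    Runs S W (.seq c d) s (T + T') Q := by
  obtain ⟨t, ht, h1, h2, h3, h4⟩ := h
  obtain ⟨u, hu, k1, k2, k3, k4⟩ := h4 t rfl rfl
  exact ⟨u, .seq ht hu, by omega, by rw [k2, h2], by rw [k3, h3], k4⟩

theorem Runs.ite {e : Expr} (he : e.Ok S W s.regs s.mem)
    (h1 : e.val s.regs s.mem ≠ 0 → ∀ t : State, t.regs = s.regs → t.mem = s.mem →
      Runs S W c t T Q)
    (h0 : e.val s.regs s.mem = 0 → ∀ t : State, t.regs = s.regs → t.mem = s.mem →
      Runs S W d t T Q) :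
    Runs S W (.ite e c d) s (e.cost + 1 + T) Q :=
  Reaches.ite he
    (fun h => Reaches.mono (h1 h (s.tick _) rfl rfl) fun t ht =>
      ⟨by simpa [State.tick, add_assoc] using ht.1, ht.2⟩)
    (fun h => Reaches.mono (h0 h (s.tick _) rfl rfl) fun t ht =>
      ⟨by simpa [State.tick, add_assoc] using ht.1, ht.2⟩)

/-- Add one to register `x`. -/
def Cmd.incr (x : ℕ) : Cmd := .assign x (.bin .plus (.reg x) (.const 1))

/-- Run `c` with register `x` going from the value of `lo` up to, but not including, the value of
register `y`. -/
def Cmd.forRange (x : ℕ) (lo : Expr) (y : ℕ) (c : Cmd) : Cmd :=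
  .seq (.assign x lo) (.loop (.bin .less (.reg x) (.reg y)) (.seq c (.incr x)))

/-- The rule for counting loops: `I k` holds whenever the loop test is about to be evaluated with
counter `k`. -/
theorem Reaches.forRange {x y : ℕ} {lo : Expr} {a b : ℕ} {I : ℕ → State → Prop}
    (hlo : lo.Ok S W s.regs s.mem) (ha : lo.val s.regs s.mem = a) (hab : a ≤ b) (hb : b + 1 < W)
    (h0 : I a ({ s with regs := Function.update s.regs x a }.tick (lo.cost + 1)))
    (hI : ∀ k t, I k t → t.regs x = k ∧ t.regs y = b)
    (hstep : ∀ k t, a ≤ k → k < b → I k t → Reaches S W c (t.tick 4) fun u =>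
      u.regs x = k ∧ I (k + 1) ({ u with regs := Function.update u.regs x (k + 1) }.tick 4)) :
    Reaches S W (.forRange x lo y c) s fun t => ∃ u, I b u ∧ t = u.tick 4 := by
  have key : ∀ j k t, b = k + j → a ≤ k → I k t →
      Reaches S W (.loop (.bin .less (.reg x) (.reg y)) (.seq c (.incr x))) t
        fun t => ∃ u, I b u ∧ t = u.tick 4 := by
    intro j
    induction j with
    | zero =>
      intro k t hk _ ht
      obtain ⟨hx, hy⟩ := hI k t ht
      refine ⟨_, .loop_false ?_ ?_, t, by rwa [hk], rfl⟩
      · simp only [Expr.Fits, Expr.eval, Op.eval, hx, hy]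
        split_ifs <;> omega
      · simp [Expr.eval, Op.eval, hx, hy, hk]
    | succ j ih =>
      intro k t hk hak ht
      obtain ⟨hx, hy⟩ := hI k t ht
      obtain ⟨u, hu, hux, hIu⟩ := hstep k t hak (by omega) ht
      obtain ⟨v, hv, hIv⟩ := ih (k + 1) _ (by omega) (by omega) hIu
      refine ⟨v, .loop_true ?_ ?_ (.seq hu ?_) hv, hIv⟩
      · simp only [Expr.Fits, Expr.eval, Op.eval, hx, hy]
        split_ifs <;> omega
      · simp only [Expr.eval, Op.eval, hx, hy]
        rw [if_pos (by omega)]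
        exact one_ne_zero
      · have := Exec.assign (S := S) (W := W) x (.bin .plus (.reg x) (.const 1)) u (by
          simp only [Expr.Fits, Expr.eval, Op.eval, hux]
          omega)
        simpa [Cmd.incr, Expr.eval, Op.eval, hux, Expr.cost] using this
  obtain ⟨t, ht, hIt⟩ := key (b - a) a _ (by omega) le_rfl h0
  refine ⟨t, .seq (.assign x lo s ((Expr.fits_iff ..).2 hlo)) ?_, hIt⟩
  simpa [Expr.eval_eq, ha] using ht

/-- The rule for counting loops without output: `τ k` bounds the time spent when the counter
reaches `k`. -/
theorem Runs.forRange {x y : ℕ} {lo : Expr} {a b : ℕ} {I : ℕ → (ℕ → ℕ) → (ℕ → ℕ) → Prop}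
    (τ T : ℕ → ℕ)
    (hlo : lo.Ok S W s.regs s.mem) (ha : lo.val s.regs s.mem = a) (hab : a ≤ b) (hb : b + 1 < W)
    (hτ : ∀ k, a ≤ k → k < b → τ k + T k + 8 ≤ τ (k + 1))
    (h0 : I a (Function.update s.regs x a) s.mem)
    (hI : ∀ k r μ, I k r μ → r x = k ∧ r y = b)
    (hstep : ∀ k (t : State), a ≤ k → k < b → I k t.regs t.mem → Runs S W c t (T k) fun r μ =>
      r x = k ∧ I (k + 1) (Function.update r x (k + 1)) μ) :
    Runs S W (.forRange x lo y c) s (τ b - τ a + lo.cost + 5) (I b) := by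
  have mono : ∀ k, a ≤ k → k ≤ b → τ a ≤ τ k := by
    intro k hk
    induction k, hk using Nat.le_induction with
    | base => exact fun _ => le_rfl
    | succ k hk ih =>
      intro hkb
      have := hτ k hk (by omega)
      have := ih (by omega)
      omega
  refine (Reaches.forRange (I := fun k t => (a ≤ k ∧ k ≤ b) ∧
      t.clock + τ a ≤ s.clock + τ k + lo.cost + 1 ∧
      t.buf = s.buf ∧ t.outs = s.outs ∧ I k t.regs t.mem) hlo ha hab hb
      ⟨⟨le_rfl, hab⟩, by simp only [State.tick]; omega, rfl, rfl, h0⟩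
      (fun k t ht => hI k _ _ ht.2.2.2.2) ?_).mono ?_
  · rintro k t hak hkb ⟨-, h1, h2, h3, h4⟩
    refine Reaches.mono (hstep k (t.tick 4) hak hkb h4) ?_
    rintro u ⟨k1, k2, k3, k4, k5⟩
    have := hτ k hak hkb
    refine ⟨k4, ⟨by omega, by omega⟩, ?_, by simpa [State.tick] using k2.trans h2,
      by simpa [State.tick] using k3.trans h3, k5⟩
    simp only [State.tick] at k1 ⊢
    omega
  · rintro t ⟨u, ⟨-, h1, h2, h3, h4⟩, rfl⟩
    have := mono b hab le_rfl
    refine ⟨?_, h2, h3, h4⟩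
    simp only [State.tick]
    omega

/-- The rule for counting loops whose iterations all take at most `T` steps. -/
theorem Runs.forRange_const {x y : ℕ} {lo : Expr} {a b : ℕ}
    {I : ℕ → (ℕ → ℕ) → (ℕ → ℕ) → Prop} (T : ℕ)
    (hlo : lo.Ok S W s.regs s.mem) (ha : lo.val s.regs s.mem = a) (hab : a ≤ b) (hb : b + 1 < W)
    (h0 : I a (Function.update s.regs x a) s.mem)
    (hI : ∀ k r μ, I k r μ → r x = k ∧ r y = b)
    (hstep : ∀ k (t : State), a ≤ k → k < b → I k t.regs t.mem → Runs S W c t T fun r μ =>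
      r x = k ∧ I (k + 1) (Function.update r x (k + 1)) μ) :
    Runs S W (.forRange x lo y c) s ((b - a) * (T + 8) + lo.cost + 5) (I b) := by
  refine (Runs.forRange (fun k => k * (T + 8)) (fun _ => T) hlo ha hab hb ?_ h0 hI hstep).mono
    (by simp only [Nat.sub_mul]; exact le_rfl) fun _ _ h => h
  intro k _ _
  simp only [add_mul, one_mul]
  omega

/-! ### Delay bookkeeping -/

/-- The outputs made so far have delay at most `D`, and at most `d` steps have passed since the
last one. The second part is encoded by saying that an output would still be in time as long as it
came no more than `D - d` steps from now. -/
def Lag (D d : ℕ) (s : State) : Prop :=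
  ∀ c', c' + d ≤ s.clock + D →
    List.IsChain (fun a b => b ≤ a + D) (0 :: (s.outs.map Prod.fst ++ [c']))

variable {D : ℕ}

theorem Lag.of_le {δ δ' : ℕ} (h : Lag D δ s) (ho : t.outs = s.outs)
    (hc : t.clock + δ ≤ s.clock + δ') : Lag D δ' t := by
  intro c' hc'
  rw [ho]
  exact h c' (by omega)

theorem Lag.emit {δ : ℕ} (h : Lag D δ s) (hd : δ + 1 ≤ D) {ls : List ℕ}
    (hc : t.clock = s.clock + 1) (ho : t.outs = s.outs ++ [(s.clock + 1, ls)]) : Lag D 0 t := by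
  intro c' hc'
  have h1 := h (s.clock + 1) (by omega)
  rw [ho]
  simp only [List.map_append, List.map_cons, List.map_nil]
  rw [← List.cons_append]
  refine List.IsChain.append h1 (List.isChain_singleton _) ?_
  intro x hx y hy
  simp only [List.head?_cons, Option.mem_some_iff] at hy
  rw [← List.cons_append, List.getLast?_append] at hx
  simp at hx
  omega

theorem Lag.delayAtMost {δ : ℕ} (h : Lag D δ s) (hd : δ ≤ D) : DelayAtMost D s :=
  h s.clock (by omega)

theorem lag_initialState (D : ℕ) (ws : List ℕ) : Lag D 0 (initialState ws) := by
  intro c' hc'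
  simp only [initialState] at hc' ⊢
  simpa using hc'

end ConnectorEnum

namespace ConnectorEnum
namespace Instance

variable {n m q : ℕ} {A : Instance n m q} {J : Finset (Fin q)} {lab : ℕ → ℕ} {i : ℕ}

/-! ### Connectors as components -/

/-- The edges of `G` between vertices that have all items of `J`. The other vertices are kept, as
isolated ones. -/
def restrict (A : Instance n m q) (J : Finset (Fin q)) : SimpleGraph (Fin n) where
  Adj u v := A.graph.Adj u v ∧ J ⊆ A.σ u ∧ J ⊆ A.σ v
  symm := ⟨fun _ _ h => ⟨h.1.symm, h.2.2, h.2.1⟩⟩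
  loopless := ⟨fun _ h => h.1.ne rfl⟩

/-- Every vertex with all items of `J` is labelled with some vertex of its component, and every
other vertex with `n`. -/
structure IsPreLabelling (A : Instance n m q) (J : Finset (Fin q)) (lab : ℕ → ℕ) : Prop where
  out : ∀ v : Fin n, ¬ J ⊆ A.σ v → lab v = n
  mem : ∀ v : Fin n, J ⊆ A.σ v → ∃ x : Fin n, lab v = x ∧ (A.restrict J).Reachable v x

/-- Every vertex with all items of `J` is labelled with the smallest vertex of its component, and
every other vertex with `n`. -/
structure IsLabelling (A : Instance n m q) (J : Finset (Fin q)) (lab : ℕ → ℕ) : Prop where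
  out : ∀ v : Fin n, ¬ J ⊆ A.σ v → lab v = n
  mem : ∀ v : Fin n, J ⊆ A.σ v → ∃ x : Fin n, lab v = x ∧ (A.restrict J).Reachable v x ∧
    ∀ u, (A.restrict J).Reachable v u → x ≤ u

/-- The label of `v` is at most every vertex that can be reached from `v` in at most `t` steps. -/
def Covers (A : Instance n m q) (J : Finset (Fin q)) (lab : ℕ → ℕ) (t : ℕ) (v : Fin n) : Prop :=
  ∀ (u : Fin n) (p : (A.restrict J).Walk v u), p.length ≤ t → lab v ≤ u

theorem IsPreLabelling.le (h : A.IsPreLabelling J lab) (v : Fin n) : lab v ≤ n := by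
  by_cases hv : J ⊆ A.σ v
  · obtain ⟨x, hx, -⟩ := h.mem v hv
    omega
  · exact (h.out v hv).le

theorem IsPreLabelling.lt_iff (h : A.IsPreLabelling J lab) (v : Fin n) :
    lab v < n ↔ J ⊆ A.σ v := by
  by_cases hv : J ⊆ A.σ v
  · obtain ⟨x, hx, -⟩ := h.mem v hv
    simp [hv, hx]
  · simp [hv, h.out v hv]

theorem IsPreLabelling.update (h : A.IsPreLabelling J lab) {u w : Fin n}
    (huw : (A.restrict J).Adj u w) : A.IsPreLabelling J (Function.update lab u (lab w)) where
  out v hv := by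
    have hne : (v : ℕ) ≠ u := fun e => hv (Fin.ext e ▸ huw.2.1)
    rw [Function.update_of_ne hne]
    exact h.out v hv
  mem v hv := by
    by_cases hvu : v = u
    · subst hvu
      obtain ⟨x, hx, hr⟩ := h.mem w huw.2.2
      exact ⟨x, by rw [Function.update_self, hx], huw.reachable.trans hr⟩
    · rw [Function.update_of_ne fun e => hvu (Fin.ext e)]
      exact h.mem v hv

/-- Components have diameter less than `n`, so that walks of length at most `n` reach everything. -/
theorem IsPreLabelling.isLabelling (h : A.IsPreLabelling J lab)
    (hc : ∀ v : Fin n, J ⊆ A.σ v → A.Covers J lab n v) : A.IsLabelling J lab where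
  out := h.out
  mem v hv := by
    obtain ⟨x, hx, hr⟩ := h.mem v hv
    refine ⟨x, hx, hr, fun u hu => ?_⟩
    obtain ⟨p, hp⟩ := hu.exists_isPath
    have := hp.length_lt
    rw [Fintype.card_fin] at this
    have := hc v hv u p this.le
    rw [hx] at this
    exact this

/-- The vertices with label `r`. -/
def fiber (n : ℕ) (lab : ℕ → ℕ) (r : ℕ) : Finset (Fin n) :=
  Finset.univ.filter fun v => lab v = r

/-- Among the items below `i`, the common items of `X` are those of `J`. -/
def HasPrefix (A : Instance n m q) (J : Finset (Fin q)) (i : ℕ) (X : Finset (Fin n)) : Prop :=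
  ∀ j : Fin q, (j : ℕ) < i → (j ∈ A.commonItems X ↔ j ∈ J)

/-- The vertex `r` labels itself, and no item below `i` outside of `J` is common to the vertices
with label `r`. -/
def Good (A : Instance n m q) (J : Finset (Fin q)) (i : ℕ) (lab : ℕ → ℕ) (r : ℕ) : Prop :=
  lab r = r ∧ ∀ j : Fin q, (j : ℕ) < i → j ∉ J → ∃ v : Fin n, lab v = r ∧ j ∉ A.σ v

theorem mem_commonItems {X : Finset (Fin n)} {j : Fin q} :
    j ∈ A.commonItems X ↔ ∀ v ∈ X, j ∈ A.σ v := by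
  simp [commonItems]

theorem mem_fiber {r : ℕ} {v : Fin n} : v ∈ fiber n lab r ↔ lab v = r := by
  simp [fiber]

theorem IsLabelling.subset_of_lt (h : A.IsLabelling J lab) {v : Fin n} (hv : lab v < n) :
    J ⊆ A.σ v := by
  by_contra hc
  exact hv.ne (h.out v hc)

theorem IsLabelling.eq_of_reachable (h : A.IsLabelling J lab) {u v : Fin n}
    (hu : J ⊆ A.σ u) (hv : J ⊆ A.σ v) (huv : (A.restrict J).Reachable u v) : lab u = lab v := by
  obtain ⟨x, hx, hux, hmin⟩ := h.mem u hu
  obtain ⟨y, hy, hvy, hmin'⟩ := h.mem v hv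
  rw [hx, hy, le_antisymm (hmin y (huv.trans hvy)) (hmin' x (huv.symm.trans hux))]

theorem IsLabelling.reachable_of_eq (h : A.IsLabelling J lab) {u v : Fin n}
    (hu : J ⊆ A.σ u) (hv : J ⊆ A.σ v) (huv : lab u = lab v) : (A.restrict J).Reachable u v := by
  obtain ⟨x, hx, hux, -⟩ := h.mem u hu
  obtain ⟨y, hy, hvy, -⟩ := h.mem v hv
  obtain rfl : x = y := Fin.ext (by omega)
  exact hux.trans hvy.symm

theorem IsLabelling.label_label (h : A.IsLabelling J lab) {v : Fin n} (hv : lab v < n) :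
    lab (lab v) = lab v := by
  have hJ := h.subset_of_lt hv
  obtain ⟨x, hx, hvx, -⟩ := h.mem v hJ
  have hxJ : J ⊆ A.σ x := by
    obtain ⟨p⟩ := hvx.symm
    cases p with
    | nil => exact hJ
    | cons e _ => exact e.2.1
  rw [hx, ← h.eq_of_reachable hJ hxJ hvx, hx]

/-- A walk in the restricted graph stays in the fibre that it starts from. -/
theorem IsLabelling.reachable_induce (h : A.IsLabelling J lab) {r : ℕ}
    {u v : Fin n} (p : (A.restrict J).Walk u v) (hu : lab u = r) (hv : lab v = r) :
    (A.graph.induce (fiber n lab r : Set (Fin n))).Reachable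
      ⟨u, by simp [fiber, hu]⟩ ⟨v, by simp [fiber, hv]⟩ := by
  induction p with
  | nil => exact SimpleGraph.Reachable.refl _
  | @cons u w v e p ih =>
    have hw : lab w = r := by rw [← hu]; exact (h.eq_of_reachable e.2.1 e.2.2 e.reachable).symm
    refine SimpleGraph.Reachable.trans (SimpleGraph.Adj.reachable ?_) (ih hw hv)
    exact e.1

theorem InducesConnected.nonempty {X : Finset (Fin n)} (h : A.InducesConnected X) :
    X.Nonempty :=
  Finset.coe_nonempty.1 (Set.nonempty_coe_sort.1 (SimpleGraph.Connected.nonempty h))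

/-- A connected set of vertices that have all items of `J` lies in one component. -/
theorem InducesConnected.reachable {X : Finset (Fin n)} (h : A.InducesConnected X)
    (hJ : ∀ v ∈ X, J ⊆ A.σ v) {u v : Fin n} (hu : u ∈ X) (hv : v ∈ X) :
    (A.restrict J).Reachable u v := by
  let f : A.graph.induce (X : Set (Fin n)) →g A.restrict J :=
    ⟨fun x => x.1, fun {a b} hab => ⟨hab, hJ _ a.2, hJ _ b.2⟩⟩
  exact (h.preconnected ⟨u, hu⟩ ⟨v, hv⟩).map f

theorem InducesConnected.insert_of_adj {X : Finset (Fin n)} (h : A.InducesConnected X) {u v : Fin n}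
    (hu : u ∈ X) (huv : A.graph.Adj u v) : A.InducesConnected (insert v X) := by
  have h2 := SimpleGraph.induce_union_connected (SimpleGraph.Connected.preconnected h)
    (SimpleGraph.induce_pair_connected_of_adj huv).preconnected ⟨u, hu, Set.mem_insert u _⟩
  have hXs : insert v (X : Set (Fin n)) = (X : Set (Fin n)) ∪ {u, v} := by
    ext x
    simp only [Set.mem_insert_iff, Finset.mem_coe, Set.mem_union, Set.mem_singleton_iff]
    constructor
    · tauto
    · rintro (h | rfl | rfl) <;> tauto
  rw [← hXs, ← Finset.coe_insert] at h2
  exact h2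

/-- In a connected set `Y`, some edge leaves every non-empty proper subset `X`. -/
theorem exists_adj_of_ssubset {X Y : Finset (Fin n)} (hY : A.InducesConnected Y)
    (hX : X.Nonempty) (h : X ⊂ Y) : ∃ u ∈ X, ∃ v ∈ Y, v ∉ X ∧ A.graph.Adj u v := by
  obtain ⟨hXY, hne⟩ := Finset.ssubset_iff_subset_ne.1 h
  obtain ⟨y, hy, hyX⟩ := Finset.exists_of_ssubset h
  obtain ⟨x, hx⟩ := hX
  obtain ⟨p⟩ := hY.preconnected ⟨x, hXY hx⟩ ⟨y, hy⟩
  obtain ⟨d, -, h1, h2⟩ := p.exists_boundary_dart {z | z.1 ∈ X} hx hyX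
  exact ⟨d.fst, h1, d.snd, d.snd.2, h2, d.adj⟩

/-- The fibre of a vertex that labels itself is a connector: a larger connected set loses an item
of `J`. -/
theorem IsLabelling.isConnector_fiber (h : A.IsLabelling J lab) {r : ℕ} (hr : r < n)
    (hg : lab r = r) : A.IsConnector (fiber n lab r) := by
  have hJ : ∀ v : Fin n, lab v = r → J ⊆ A.σ v := fun v hv => h.subset_of_lt (by omega)
  have hconn : A.InducesConnected (fiber n lab r) := by
    refine (SimpleGraph.connected_iff _).2 ⟨?_, ⟨⟨⟨r, hr⟩, by simpa [fiber] using hg⟩⟩⟩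
    rintro ⟨u, hu⟩ ⟨v, hv⟩
    replace hu := mem_fiber.1 (Finset.mem_coe.1 hu)
    replace hv := mem_fiber.1 (Finset.mem_coe.1 hv)
    obtain ⟨p⟩ := h.reachable_of_eq (hJ u hu) (hJ v hv) (hu.trans hv.symm)
    exact h.reachable_induce p hu hv
  refine ⟨hconn, fun v hv => ?_⟩
  by_contra! hc
  obtain ⟨hins, hnss⟩ := hc
  refine hnss ⟨fun j hj => ?_, fun hsub => ?_⟩
  · rw [mem_commonItems] at hj ⊢
    exact fun u hu => hj u (Finset.mem_insert_of_mem hu)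
  · -- otherwise `v` has all items of `J`, and lies in the same component
    have hall : ∀ u ∈ insert v (fiber n lab r), J ⊆ A.σ u := by
      intro u hu j hj
      exact mem_commonItems.1 (hsub (mem_commonItems.2 fun w hw => hJ w (mem_fiber.1 hw) hj)) u hu
    have hrm : (⟨r, hr⟩ : Fin n) ∈ fiber n lab r := mem_fiber.2 hg
    have := hins.reachable hall (Finset.mem_insert_self _ _) (Finset.mem_insert_of_mem hrm)
    have := h.eq_of_reachable (hall _ (Finset.mem_insert_self _ _)) (hJ _ hg) this
    exact hv (mem_fiber.2 (this.trans hg))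

theorem IsLabelling.hasPrefix_fiber (h : A.IsLabelling J lab) {r : ℕ} (hr : r < n)
    (hg : A.Good J i lab r) : A.HasPrefix J i (fiber n lab r) := by
  intro j hj
  rw [mem_commonItems]
  constructor
  · intro hall
    by_contra hjJ
    obtain ⟨v, hv, hjv⟩ := hg.2 j hj hjJ
    exact hjv (hall v (mem_fiber.2 hv))
  · intro hjJ v hv
    exact h.subset_of_lt (by rw [mem_fiber.1 hv]; exact hr) hjJ

/-- A connected set with the given prefix of common items lies in a good fibre. -/
theorem IsLabelling.exists_good (h : A.IsLabelling J lab) (hJ : ∀ j ∈ J, (j : ℕ) < i)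
    {X : Finset (Fin n)} (hX : A.InducesConnected X) (hp : A.HasPrefix J i X) :
    ∃ r < n, A.Good J i lab r ∧ X ⊆ fiber n lab r := by
  obtain ⟨x, hx⟩ := InducesConnected.nonempty hX
  have hall : ∀ v ∈ X, J ⊆ A.σ v := fun v hv j hj =>
    mem_commonItems.1 ((hp j (hJ j hj)).2 hj) v hv
  obtain ⟨y, hy, -⟩ := h.mem x (hall x hx)
  have hlt : lab x < n := by omega
  have hsub : X ⊆ fiber n lab (lab x) := fun v hv =>
    mem_fiber.2 (h.eq_of_reachable (hall v hv) (hall x hx) (hX.reachable hall hv hx))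
  refine ⟨lab x, hlt, ⟨h.label_label hlt, fun j hj hjJ => ?_⟩, hsub⟩
  have : j ∉ A.commonItems X := fun hc => hjJ ((hp j hj).1 hc)
  rw [mem_commonItems] at this
  push Not at this
  obtain ⟨v, hv, hjv⟩ := this
  exact ⟨v, mem_fiber.1 (hsub hv), hjv⟩

theorem IsLabelling.exists_isConnector_iff (h : A.IsLabelling J lab)
    (hJ : ∀ j ∈ J, (j : ℕ) < i) :
    (∃ r < n, A.Good J i lab r) ↔ ∃ X, A.IsConnector X ∧ A.HasPrefix J i X := by
  constructor
  · rintro ⟨r, hr, hg⟩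
    exact ⟨_, h.isConnector_fiber hr hg.1, h.hasPrefix_fiber hr hg⟩
  · rintro ⟨X, hX, hp⟩
    obtain ⟨r, hr, hg, -⟩ := h.exists_good hJ hX.1 hp
    exact ⟨r, hr, hg⟩

/-- The good fibres are the connectors whose set of common items is exactly `J`. -/
theorem IsLabelling.isConnector_iff (h : A.IsLabelling J lab) {X : Finset (Fin n)} :
    (A.IsConnector X ∧ A.HasPrefix J q X) ↔ ∃ r < n, A.Good J q lab r ∧ fiber n lab r = X := by
  constructor
  · rintro ⟨hX, hp⟩
    obtain ⟨r, hr, hg, hsub⟩ := h.exists_good (fun j _ => j.2) hX.1 hp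
    refine ⟨r, hr, hg, ?_⟩
    by_contra hne
    obtain ⟨u, hu, v, hv, hvX, huv⟩ := exists_adj_of_ssubset (h.isConnector_fiber hr hg.1).1
      (InducesConnected.nonempty hX.1) (Finset.ssubset_iff_subset_ne.2 ⟨hsub, fun e => hne e.symm⟩)
    rcases hX.2 v hvX with hc | hc
    · exact hc (hX.1.insert_of_adj hu huv)
    · refine hc.2 fun j hj => ?_
      have hjJ : j ∈ J := (hp j j.2).1 hj
      rw [mem_commonItems] at hj ⊢
      intro w hw
      rcases Finset.mem_insert.1 hw with rfl | hw
      · exact h.subset_of_lt (by rw [mem_fiber.1 hv]; exact hr) hjJ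
      · exact hj w hw
  · rintro ⟨r, hr, hg, rfl⟩
    exact ⟨h.isConnector_fiber hr hg.1, h.hasPrefix_fiber hr hg⟩

end Instance
end ConnectorEnum

namespace ConnectorEnum

/-! ### The input in memory -/

theorem getD_append_add {α : Type*} (l l' : List α) (k : ℕ) (d : α) :
    (l ++ l').getD (l.length + k) d = l'.getD k d := by
  rw [List.getD_append_right _ _ _ _ (by omega), Nat.add_sub_cancel_left]

theorem getD_flatMap {α : Type*} {n : ℕ} (f : Fin n → List α) (u : Fin n) {k : ℕ}
    (hk : k < (f u).length) (d : α) :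
    ((List.finRange n).flatMap f).getD
      ((((List.finRange n).take u).map fun v => (f v).length).sum + k) d = (f u).getD k d := by
  have hu : (u : ℕ) < (List.finRange n).length := by simp
  have h1 : (List.finRange n).flatMap f = ((List.finRange n).take u).flatMap f ++
      (f u ++ ((List.finRange n).drop (u + 1)).flatMap f) := by
    conv_lhs => rw [← List.take_append_drop u (List.finRange n), List.drop_eq_getElem_cons hu]
    simp
  rw [h1, ← List.length_flatMap, getD_append_add, List.getD_append _ _ _ _ hk]

namespace Instance

variable {n m q : ℕ} {A : Instance n m q}

/-- `w` is the content of a memory that starts with the input: the offsets `off`, then the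
adjacency lists, and then the item bits. -/
structure IsImage (A : Instance n m q) (off w : ℕ → ℕ) : Prop where
  vertices : w 0 = n
  items : w 2 = q
  offset : ∀ u ≤ n, w (3 + u) = off u
  off_zero : off 0 = 0
  off_mono : Monotone off
  off_le : off n ≤ 2 * m
  adj_of_nbr : ∀ (u : Fin n) (p : ℕ), off u ≤ p → p < off (u + 1) →
    ∃ x : Fin n, w (n + 4 + p) = x ∧ A.graph.Adj u x
  exists_nbr : ∀ u x : Fin n, A.graph.Adj u x →
    ∃ p, off u ≤ p ∧ p < off (u + 1) ∧ w (n + 4 + p) = x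
  item : ∀ (v : Fin n) (j : Fin q),
    w (n + 4 + off n + (v * q + j)) = if j ∈ A.σ v then 1 else 0

/-- The offset of the adjacency list of the vertex `k`. -/
def offset (adj : Fin n → List (Fin n)) (k : ℕ) : ℕ :=
  (((List.finRange n).take k).map fun v => (adj v).length).sum

theorem offset_succ (adj : Fin n → List (Fin n)) (u : Fin n) :
    offset adj (u + 1) = offset adj u + (adj u).length := by
  have hu : (u : ℕ) < (List.finRange n).length := by simp
  unfold offset
  rw [List.take_succ_eq_append_getElem hu]
  simp

theorem offset_mono (adj : Fin n → List (Fin n)) : Monotone (offset adj) := by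
  refine monotone_nat_of_le_succ fun k => ?_
  by_cases hk : k < n
  · have := offset_succ adj ⟨k, hk⟩
    simp only at this
    omega
  · unfold offset
    rw [List.take_of_length_le (by simp; omega), List.take_of_length_le (by simp; omega)]

theorem offset_self (adj : Fin n → List (Fin n)) : offset adj n = ∑ u, (adj u).length := by
  unfold offset
  rw [List.take_of_length_le (by simp), ← List.ofFn_eq_map, List.sum_ofFn]

/-- Every edge has at most two entries in the adjacency lists. -/
theorem IsAdjacencyList.offset_le {adj : Fin n → List (Fin n)} (h : A.IsAdjacencyList adj) :
    offset adj n ≤ 2 * m := by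
  have h1 : ∀ u, (adj u).length = ∑ v, (adj u).count v := fun u => by
    simp only [← Multiset.coe_count, ← Multiset.coe_card]
    exact (Multiset.sum_count_eq_card fun a _ => Finset.mem_univ a).symm
  have h2 : ∀ e : Fin m, ∑ u, ∑ v, (if A.ends e = s(u, v) then 1 else 0) ≤ 2 := by
    intro e
    rw [← Fintype.sum_prod_type' (f := fun u v => if A.ends e = s(u, v) then 1 else 0),
      ← Finset.card_filter]
    obtain ⟨a, b, hab⟩ : ∃ a b, A.ends e = s(a, b) := by
      induction A.ends e using Sym2.ind with
      | _ a b => exact ⟨a, b, rfl⟩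
    refine (Finset.card_le_card (t := {(a, b), (b, a)}) ?_).trans Finset.card_le_two
    rintro ⟨u, v⟩ huv
    simp only [Finset.mem_filter, Finset.mem_univ, true_and, hab, Sym2.eq_iff] at huv
    simp only [Finset.mem_insert, Finset.mem_singleton, Prod.mk.injEq]
    rcases huv with ⟨rfl, rfl⟩ | ⟨rfl, rfl⟩ <;> simp
  calc offset adj n = ∑ u, ∑ v, ∑ e, (if A.ends e = s(u, v) then 1 else 0) := by
        rw [offset_self]
        refine Finset.sum_congr rfl fun u _ => ?_
        rw [h1]
        refine Finset.sum_congr rfl fun v _ => ?_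
        rw [h u v, Finset.card_filter]
    _ = ∑ e, ∑ u, ∑ v, (if A.ends e = s(u, v) then 1 else 0) := by
        rw [Finset.sum_comm]
        conv_rhs => rw [Finset.sum_comm]; enter [2, u]; rw [Finset.sum_comm]
        rw [Finset.sum_comm]
    _ ≤ ∑ _e : Fin m, 2 := Finset.sum_le_sum fun e _ => h2 e
    _ = 2 * m := by simp [mul_comm]

/-- In the definition of the input, the conversion of the adjacency lists to lists of words is
elaborated as a monadic coercion of lists. -/
theorem inputWords_eq (adj : Fin n → List (Fin n)) :
    A.inputWords adj = [n, m, q] ++ (List.range (n + 1)).map (offset adj) ++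
      (List.finRange n).flatMap (fun v => (adj v).map Fin.val) ++
      (List.finRange n).flatMap
        (fun v => (List.finRange q).map fun i => if i ∈ A.σ v then 1 else 0) := by
  have : ∀ l : List (Fin n), (do let a ← l; pure (a : ℕ)) = l.map Fin.val := fun l => by
    simp [List.map_eq_flatMap]
  unfold inputWords
  simp only [this, List.map_id']
  rfl

theorem length_inputWords (adj : Fin n → List (Fin n)) :
    (A.inputWords adj).length = n + 4 + offset adj n + n * q := by
  rw [inputWords_eq]
  simp only [List.length_append, List.length_map, List.length_range, List.length_flatMap,
    List.length_finRange, List.map_const', List.sum_replicate, smul_eq_mul]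
  have : ((List.finRange n).map fun v => (adj v).length).sum = offset adj n := by
    unfold offset
    rw [List.take_of_length_le (by simp)]
  simp only [List.length_cons, List.length_nil]
  omega

theorem mem_adj_iff {adj : Fin n → List (Fin n)} (h : A.IsAdjacencyList adj) {u v : Fin n} :
    v ∈ adj u ↔ A.graph.Adj u v := by
  rw [← List.count_pos_iff, h u v, Finset.card_pos]
  constructor
  · rintro ⟨e, he⟩
    exact ⟨e, by simpa using he⟩
  · rintro ⟨e, he⟩
    exact ⟨e, by simpa using he⟩

theorem isImage_inputWords {adj : Fin n → List (Fin n)} (h : A.IsAdjacencyList adj) :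
    A.IsImage (offset adj) fun a => (A.inputWords adj).getD a 0 := by
  have nbr : ∀ (u : Fin n) (k : ℕ) (hk : k < (adj u).length),
      (A.inputWords adj).getD (n + 4 + (offset adj u + k)) 0 = (adj u)[k] := by
    intro u k hk
    rw [inputWords_eq]
    have hu := offset_succ adj u
    have hle := offset_mono adj (show (u : ℕ) + 1 ≤ n from u.2)
    have hlen : ((List.finRange n).flatMap fun v => (adj v).map Fin.val).length
        = offset adj n := by
      simp only [List.length_flatMap, List.length_map]
      unfold offset
      rw [List.take_of_length_le (by simp)]
    have h2 := getD_flatMap (fun v => (adj v).map Fin.val) u (k := k) (by simpa) 0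
    simp only [List.length_map] at h2
    rw [List.getD_append _ _ _ _ (by
      simp only [List.length_append, List.length_cons, List.length_nil, List.length_map,
        List.length_range, hlen]
      omega)]
    have h3 := getD_append_add ([n, m, q] ++ (List.range (n + 1)).map (offset adj))
      ((List.finRange n).flatMap fun v => (adj v).map Fin.val) (offset adj u + k) 0
    have h4 : ([n, m, q] ++ (List.range (n + 1)).map (offset adj)).length = n + 4 := by
      simp
    rw [h4] at h3
    refine h3.trans (h2.trans ?_)
    simp [hk]
  refine ⟨rfl, rfl, ?_, ?_, offset_mono adj, h.offset_le, ?_, ?_, ?_⟩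
  · intro u hu
    rw [inputWords_eq]
    rw [List.append_assoc, List.append_assoc]
    have := getD_append_add [n, m, q] ((List.range (n + 1)).map (offset adj) ++
      ((List.finRange n).flatMap (fun v => (adj v).map Fin.val) ++
      (List.finRange n).flatMap
        (fun v => (List.finRange q).map fun i => if i ∈ A.σ v then 1 else 0))) u 0
    refine this.trans ?_
    rw [List.getD_append _ _ _ _ (by simp; omega)]
    simp [List.getD_eq_getElem?_getD, show u < n + 1 by omega]
  · simp [offset]
  · intro u p h1 h2
    have hs := offset_succ adj u
    have hk : p - offset adj u < (adj u).length := by omega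
    have := nbr u _ hk
    rw [Nat.add_sub_cancel' h1] at this
    exact ⟨_, this, (mem_adj_iff h).1 (List.getElem_mem hk)⟩
  · intro u x hux
    obtain ⟨k, hk, rfl⟩ := List.getElem_of_mem ((mem_adj_iff h).2 hux)
    have hs := offset_succ adj u
    exact ⟨offset adj u + k, by omega, by omega, nbr u k hk⟩
  · intro v j
    rw [inputWords_eq]
    have hlen : ([n, m, q] ++ (List.range (n + 1)).map (offset adj) ++
        (List.finRange n).flatMap (fun v => (adj v).map Fin.val)).length
        = n + 4 + offset adj n := by
      simp only [List.length_append, List.length_cons, List.length_nil, List.length_map,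
        List.length_range, List.length_flatMap]
      unfold offset
      rw [List.take_of_length_le (l := List.finRange n) (by simp)]
      omega
    have h3 := getD_append_add ([n, m, q] ++ (List.range (n + 1)).map (offset adj) ++
        (List.finRange n).flatMap (fun v => (adj v).map Fin.val))
      ((List.finRange n).flatMap
        (fun v => (List.finRange q).map fun i => if i ∈ A.σ v then 1 else 0)) (v * q + j) 0
    rw [hlen] at h3
    refine h3.trans ?_
    have h2 := getD_flatMap
      (fun v => (List.finRange q).map fun i => if i ∈ A.σ v then 1 else 0) v (k := j) (by simp) 0
    simp only [List.length_map, List.length_finRange, List.map_const', List.sum_replicate,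
      List.length_take, smul_eq_mul, Nat.min_eq_left v.2.le] at h2
    rw [h2]
    simp [List.getD_eq_getElem?_getD]

end Instance
end ConnectorEnum

namespace ConnectorEnum

/-! ### The memory of the program -/

/-- The registers `0` to `6`: the numbers of vertices and items, the addresses of the adjacency
lists, of the item bits, of the bits of the current prefix, and of the labels, and the length `i`
of the current prefix. -/
structure RegsOk (n q a i : ℕ) (r : ℕ → ℕ) : Prop where
  r0 : r 0 = n
  r1 : r 1 = q
  r2 : r 2 = n + 4
  r3 : r 3 = n + 4 + a
  r4 : r 4 = n + 4 + a + n * q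
  r5 : r 5 = n + 4 + a + n * q + q
  r6 : r 6 = i

/-- The memory `μ` holds the input, as in `w`, followed by the bits `b` of the current prefix and
the labels `lab`; the adjacency lists have `a` entries. -/
structure Rep (n q a : ℕ) (w b lab μ : ℕ → ℕ) : Prop where
  input : ∀ x < n + 4 + a + n * q, μ x = w x
  bit : ∀ j < q, μ (n + 4 + a + n * q + j) = b j
  label : ∀ v < n, μ (n + 4 + a + n * q + q + v) = lab v

/-- The register contents `r` and `r'` agree below register `k`. The variables of nested loops and
subprograms have increasing register numbers, so that what a subprogram leaves alone can be
expressed in this form. -/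
def Agree (k : ℕ) (r r' : ℕ → ℕ) : Prop := ∀ x < k, r' x = r x

variable {n m q i a S W : ℕ} {A : Instance n m q} {off w b lab μ r r' r'' : ℕ → ℕ}
  {s : State}

theorem Agree.refl (k : ℕ) (r : ℕ → ℕ) : Agree k r r := fun _ _ => rfl

theorem Agree.trans {k : ℕ} (h : Agree k r r') (h' : Agree k r' r'') : Agree k r r'' :=
  fun x hx => (h' x hx).trans (h x hx)

theorem Agree.mono {k l : ℕ} (h : Agree k r r') (hl : l ≤ k) : Agree l r r' :=
  fun x hx => h x (hx.trans_le hl)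

theorem Agree.update {k x v : ℕ} (h : Agree k r r') (hx : k ≤ x) :
    Agree k r (Function.update r' x v) := fun y hy => by
  rw [Function.update_of_ne (by omega)]
  exact h y hy

theorem RegsOk.agree {k : ℕ} (h : RegsOk n q a i r) (hr : Agree k r r') (hk : 7 ≤ k) :
    RegsOk n q a i r' where
  r0 := (hr 0 (by omega)).trans h.r0
  r1 := (hr 1 (by omega)).trans h.r1
  r2 := (hr 2 (by omega)).trans h.r2
  r3 := (hr 3 (by omega)).trans h.r3
  r4 := (hr 4 (by omega)).trans h.r4
  r5 := (hr 5 (by omega)).trans h.r5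
  r6 := (hr 6 (by omega)).trans h.r6

theorem Rep.store_bit (h : Rep n q a w b lab μ) {j x : ℕ} (hj : j < q) :
    Rep n q a w (Function.update b j x) lab
      (Function.update μ (n + 4 + a + n * q + j) x) where
  input y hy := by rw [Function.update_of_ne (by omega)]; exact h.input y hy
  bit k hk := by
    by_cases hkj : k = j
    · subst hkj; simp
    · rw [Function.update_of_ne (by omega), Function.update_of_ne hkj]; exact h.bit k hk
  label v hv := by rw [Function.update_of_ne (by omega)]; exact h.label v hv

theorem Rep.store_label (h : Rep n q a w b lab μ) {v x : ℕ} :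
    Rep n q a w b (Function.update lab v x)
      (Function.update μ (n + 4 + a + n * q + q + v) x) where
  input y hy := by rw [Function.update_of_ne (by omega)]; exact h.input y hy
  bit k hk := by rw [Function.update_of_ne (by omega)]; exact h.bit k hk
  label u hu := by
    by_cases huv : u = v
    · subst huv; simp
    · rw [Function.update_of_ne (by omega), Function.update_of_ne huv]; exact h.label u hu

/-- The item bits of a vertex `v` stay inside the bit matrix. -/
theorem index_lt {v j : ℕ} (hv : v < n) (hj : j < q) : v * q + j < n * q := by
  have := Nat.mul_le_mul_right q (show v + 1 ≤ n from hv)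
  rw [add_mul, one_mul] at this
  omega

/-- The machine has room for the input, the prefix, and the labels, and its words can hold all
addresses. -/
structure Room (A : Instance n m q) (off w : ℕ → ℕ) (S W : ℕ) : Prop where
  image : A.IsImage off w
  size : n + 4 + off n + n * q + q + n ≤ S
  word : S < W

/-- The items of the current prefix. -/
def prefixSet (q : ℕ) (b : ℕ → ℕ) (i : ℕ) : Finset (Fin q) :=
  Finset.univ.filter fun j => (j : ℕ) < i ∧ b j ≠ 0

theorem mem_prefixSet {j : Fin q} : j ∈ prefixSet q b i ↔ (j : ℕ) < i ∧ b j ≠ 0 := by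
  simp [prefixSet]

theorem Rep.item (h : Rep n q (off n) w b lab μ) (hA : A.IsImage off w) {v j : ℕ} (hv : v < n)
    (hj : j < q) : μ (n + 4 + off n + (v * q + j)) =
      if (⟨j, hj⟩ : Fin q) ∈ A.σ ⟨v, hv⟩ then 1 else 0 := by
  rw [h.input _ (by have := index_lt hv hj; omega)]
  exact hA.item ⟨v, hv⟩ ⟨j, hj⟩

/-! ### The program -/

/-- The address of the label of the vertex in register `x`. -/
def labelAddr (x : ℕ) : Expr := .bin .plus (.reg 5) (.reg x)

/-- The address of the prefix bit of the item in register `x`. -/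
def bitAddr (x : ℕ) : Expr := .bin .plus (.reg 4) (.reg x)

/-- The bit that tells whether the vertex in register `x` has the item in register `y`. -/
def itemBit (x y : ℕ) : Expr :=
  .load (.bin .plus (.reg 3) (.bin .plus (.bin .times (.reg x) (.reg 1)) (.reg y)))

/-- Label every vertex that has all items of the current prefix with itself, and every other vertex
with `n`. -/
def initLabels : Cmd :=
  .forRange 9 (.const 0) 0 (.seq (.store (labelAddr 9) (.reg 9))
    (.forRange 10 (.const 0) 6
      (.ite (.bin .less (itemBit 9 10) (.load (bitAddr 10)))
        (.store (labelAddr 9) (.reg 0)) .skip)))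

theorem runs_initLabels (hA : Room A off w S W) (hi : i ≤ q) (hb : ∀ j < q, b j ≤ 1)
    (hr : RegsOk n q (off n) i s.regs) (hm : Rep n q (off n) w b lab s.mem) :
    Runs S W initLabels s (n * (q * 30 + 30) + 10) fun r μ => Agree 8 s.regs r ∧
      ∃ lab', Rep n q (off n) w b lab' μ ∧
        ∀ v : Fin n, lab' v = if prefixSet q b i ⊆ A.σ v then (v : ℕ) else n := by
  have h1 := hA.size
  have h2 := hA.word
  refine (Runs.forRange_const (a := 0) (b := n)
    (I := fun k r μ => r 9 = k ∧ Agree 8 s.regs r ∧ ∃ lab', Rep n q (off n) w b lab' μ ∧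
      ∀ v : Fin n, (v : ℕ) < k → lab' v = if prefixSet q b i ⊆ A.σ v then (v : ℕ) else n)
    (q * 30 + 20) ?_ rfl (Nat.zero_le _) (by omega) ?_ ?_ ?_).mono ?_ ?_
  · simp only [Expr.Ok]; omega
  · exact ⟨by simp, (Agree.refl 8 _).update (by norm_num), lab, hm, by simp⟩
  · rintro k r μ ⟨hk, hag, -⟩
    exact ⟨hk, (hr.agree hag (by norm_num)).r0⟩
  · rintro k t - hkn ⟨hk, hag, lab', hm', hlab⟩
    have hr' := hr.agree hag (by norm_num)
    refine (Runs.seq (Runs.store ?_ ?_ ?_ fun u hu hu' =>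
      Runs.forRange_const (a := 0) (b := i)
        (I := fun j r μ => r 10 = j ∧ r 9 = k ∧ Agree 8 s.regs r ∧
          ∃ lab', Rep n q (off n) w b lab' μ ∧
          (∀ v : Fin n, (v : ℕ) < k →
            lab' v = if prefixSet q b i ⊆ A.σ v then (v : ℕ) else n) ∧
          lab' k = if prefixSet q b j ⊆ A.σ ⟨k, hkn⟩ then k else n)
        22 ?_ rfl (Nat.zero_le _) (by omega) ?_ ?_ ?_)).mono ?_ ?_
    · simp only [labelAddr, Expr.Ok, Expr.val, Op.eval, hr'.r5, hk]; omega
    · simp only [Expr.Ok, hk]; omega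
    · simp only [labelAddr, Expr.val, Op.eval, hr'.r5, hk]; omega
    · simp only [Expr.Ok]; omega
    · rw [hu, hu']
      simp only [labelAddr, Expr.val, Op.eval, hr'.r5, hk]
      refine ⟨by simp, by simpa using hk, hag.update (by norm_num), _, hm'.store_label, ?_, ?_⟩
      · intro v hv
        rw [Function.update_of_ne (by omega)]
        exact hlab v hv
      · rw [Function.update_self, if_pos]
        intro x hx
        simp [mem_prefixSet] at hx
    · rintro j r μ ⟨hj, hk, hag, -⟩
      exact ⟨hj, (hr.agree hag (by norm_num)).r6⟩
    · rintro j v - hji ⟨hj, hk, hag, lab', hm', hlab, hlabk⟩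
      have hr' := hr.agree hag (by norm_num)
      have hjq : j < q := by omega
      have hidx := index_lt hkn hjq
      have hkq : k * q ≤ n * q := Nat.mul_le_mul_right q hkn.le
      have hitem := hm'.item hA.image hkn hjq
      have hbit := hm'.bit j hjq
      have hbj := hb j hjq
      have hpre : prefixSet q b (j + 1) ⊆ A.σ ⟨k, hkn⟩ ↔
          prefixSet q b j ⊆ A.σ ⟨k, hkn⟩ ∧ (b j ≠ 0 → (⟨j, hjq⟩ : Fin q) ∈ A.σ ⟨k, hkn⟩) := by
        simp only [Finset.subset_iff, mem_prefixSet]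
        constructor
        · exact fun h => ⟨fun x hx => h ⟨by omega, hx.2⟩, fun hx => h ⟨by simp, hx⟩⟩
        · rintro ⟨h, h'⟩ x ⟨hx, hx'⟩
          rcases Nat.lt_succ_iff_lt_or_eq.1 hx with hx | hx
          · exact h ⟨hx, hx'⟩
          · obtain rfl : x = ⟨j, hjq⟩ := Fin.ext hx
            exact h' hx'
      have hcond : (Expr.bin .less (itemBit 9 10) (.load (bitAddr 10))).val v.regs v.mem =
          if (⟨j, hjq⟩ : Fin q) ∉ A.σ ⟨k, hkn⟩ ∧ b j ≠ 0 then 1 else 0 := by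
        simp only [itemBit, bitAddr, Expr.val, Op.eval, hr'.r3, hr'.r4, hr'.r1, hj, hk, hitem, hbit]
        by_cases hmem : (⟨j, hjq⟩ : Fin q) ∈ A.σ ⟨k, hkn⟩ <;>
          rcases (show b j = 0 ∨ b j = 1 by omega) with h | h <;> simp [hmem, h]
      refine (Runs.ite (T := 8) ?_ ?_ ?_).mono (by simp [itemBit, bitAddr, Expr.cost])
        fun _ _ h => h
      · simp only [itemBit, bitAddr, Expr.Ok, Expr.val, Op.eval, hr'.r3, hr'.r4, hr'.r1, hj, hk,
          hitem, hbit]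
        have : (if (⟨j, hjq⟩ : Fin q) ∈ A.σ ⟨k, hkn⟩ then 1 else 0) ≤ 1 := by split_ifs <;> omega
        refine ⟨by omega, by omega, ?_⟩
        split_ifs <;> omega
      · intro hne t' ht ht'
        rw [hcond] at hne
        simp only [ne_eq, ite_eq_right_iff, one_ne_zero, imp_false, not_not] at hne
        refine (Runs.store ?_ ?_ ?_ ?_).mono (by simp [labelAddr, Expr.cost]) fun _ _ h => h
        · simp only [labelAddr, Expr.Ok, Expr.val, Op.eval, ht, hr'.r5, hk]; omega
        · simp only [Expr.Ok, ht, hr'.r0]; omega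
        · simp only [labelAddr, Expr.val, Op.eval, ht, hr'.r5, hk]; omega
        · simp only [labelAddr, Expr.val, Op.eval, ht, ht', hr'.r5, hr'.r0, hk]
          refine ⟨hj, by simp, by simpa using hk, hag.update (by norm_num), _, hm'.store_label,
            ?_, ?_⟩
          · intro v hv
            rw [Function.update_of_ne (by omega)]
            exact hlab v hv
          · rw [Function.update_self, if_neg]
            exact fun h => hne.1 ((hpre.1 h).2 hne.2)
      · intro hne t' ht ht'
        rw [hcond] at hne
        simp only [ite_eq_right_iff, one_ne_zero, imp_false, not_and, not_not] at hne
        refine (Runs.skip ?_).mono (by norm_num) fun _ _ h => h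
        rw [ht, ht']
        refine ⟨hj, by simp, by simpa using hk, hag.update (by norm_num), _, hm', hlab, ?_⟩
        rw [hlabk]
        refine if_congr ?_ rfl rfl
        rw [hpre]
        exact ⟨fun h => ⟨h, fun hx => by_contra fun hc => hx (hne hc)⟩, fun h => h.1⟩
    · simp only [labelAddr, Expr.cost]; omega
    · rintro r μ ⟨hj, hk, hag, lab', hm', hlab, hlabk⟩
      refine ⟨hk, by simp, hag.update (by norm_num), lab', hm', fun v hv => ?_⟩
      rcases Nat.lt_succ_iff_lt_or_eq.1 hv with hv | hv
      · exact hlab v hv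
      · obtain rfl : v = ⟨k, hkn⟩ := Fin.ext hv
        exact hlabk
  · simp only [Expr.cost]; have : q * 30 + 20 + 8 ≤ q * 30 + 30 := by omega
    have := Nat.mul_le_mul_left n this
    simp only [Nat.sub_zero]; omega
  · rintro r μ ⟨-, hag, lab', hm', hlab⟩
    exact ⟨hag, lab', hm', fun v => hlab v v.2⟩

variable {J : Finset (Fin q)}

/-! ### Computing the components -/

namespace Instance

theorem Covers.of_le {t : ℕ} {v : Fin n} {lab' : ℕ → ℕ} (h : A.Covers J lab t v)
    (hl : lab' v ≤ lab v) : A.Covers J lab' t v :=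
  fun u p hp => hl.trans (h u p hp)

theorem covers_zero {v : Fin n} (h : lab v ≤ v) : A.Covers J lab 0 v := fun u p hp => by
  rw [← SimpleGraph.Walk.eq_of_length_eq_zero (Nat.le_zero.1 hp)]
  exact h

theorem Covers.succ {t : ℕ} {v : Fin n} (h : A.Covers J lab t v)
    (h' : ∀ x y, (A.restrict J).Adj v x → ∀ p : (A.restrict J).Walk x y, p.length ≤ t →
      lab v ≤ y) : A.Covers J lab (t + 1) v := by
  intro u p hp
  cases p with
  | nil => exact h v .nil (Nat.zero_le _)
  | cons e p => exact h' _ _ e p (by simpa using hp)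

/-- Replacing the label of `u` by a smaller label of a neighbour, where that is possible, makes no
label larger. -/
theorem IsPreLabelling.relax (h : A.IsPreLabelling J lab) {u x : Fin n} (hux : A.graph.Adj u x)
    (hxu : lab x < lab u) (hu : lab u < n) :
    A.IsPreLabelling J (Function.update lab u (lab x)) ∧
      ∀ v, Function.update lab u (lab x) v ≤ lab v := by
  refine ⟨h.update ⟨hux, (h.lt_iff u).1 hu, (h.lt_iff x).1 (hxu.trans hu)⟩, fun v => ?_⟩
  by_cases hv : v = u
  · rw [hv, Function.update_self]
    exact hxu.le
  · rw [Function.update_of_ne hv]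

end Instance

open Instance

/-- One step of `propagate`: the vertex in register `10` takes over the label of the vertex in
register `13`, if that is smaller. -/
def relaxLabel : Cmd :=
  .ite (.bin .times (.bin .less (.load (labelAddr 13)) (.load (labelAddr 10)))
      (.bin .less (.load (labelAddr 10)) (.reg 0)))
    (.store (labelAddr 10) (.load (labelAddr 13))) .skip

theorem runs_relaxLabel (hA : Room A off w S W) (hr : RegsOk n q (off n) i s.regs)
    (hm : Rep n q (off n) w b lab s.mem) (hl : A.IsPreLabelling J lab) {u x : Fin n}
    (hux : A.graph.Adj u x) (hu : s.regs 10 = u) (hx : s.regs 13 = x) :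
    Runs S W relaxLabel s 25 fun r μ => r = s.regs ∧
      ∃ lab', Rep n q (off n) w b lab' μ ∧ A.IsPreLabelling J lab' ∧ (∀ v, lab' v ≤ lab v) ∧
        (J ⊆ A.σ u → lab' u ≤ lab x) := by
  have h1 := hA.size
  have h2 := hA.word
  have hlu := hm.label u u.2
  have hlx := hm.label x x.2
  have hu' := hl.le u
  have hx' := hl.le x
  have hun := u.2
  have hxn := x.2
  refine (Runs.ite (T := 8) ?_ ?_ ?_).mono (by simp [labelAddr, Expr.cost]) fun _ _ h => h
  · simp only [labelAddr, Expr.Ok, Expr.val, Op.eval, hr.r5, hr.r0, hu, hx, hlu, hlx]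
    refine ⟨⟨by omega, by omega, ?_⟩, ⟨by omega, by omega, ?_⟩, ?_⟩ <;> split_ifs <;> omega
  · intro hne t ht ht'
    have hc : lab x < lab u ∧ lab u < n := by
      simp only [labelAddr, Expr.val, Op.eval, hr.r5, hr.r0, hu, hx, hlu, hlx] at hne
      split_ifs at hne <;> simp_all
    refine (Runs.store ?_ ?_ ?_ ?_).mono (by simp [labelAddr, Expr.cost]) fun _ _ h => h
    · simp only [labelAddr, Expr.Ok, Expr.val, Op.eval, ht, hr.r5, hu]; omega
    · simp only [labelAddr, Expr.Ok, Expr.val, Op.eval, ht, ht', hr.r5, hx, hlx]; omega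
    · simp only [labelAddr, Expr.val, Op.eval, ht, hr.r5, hu]; omega
    · simp only [labelAddr, Expr.val, Op.eval, ht, ht', hr.r5, hu, hx, hlx]
      obtain ⟨k1, k2⟩ := hl.relax hux hc.1 hc.2
      exact ⟨trivial, _, hm.store_label, k1, k2, fun _ => by rw [Function.update_self]⟩
  · intro he t ht ht'
    refine (Runs.skip ?_).mono (by norm_num) fun _ _ h => h
    rw [ht, ht']
    refine ⟨rfl, lab, hm, hl, fun _ => le_rfl, fun hJ => ?_⟩
    have := (hl.lt_iff u).2 hJ
    by_contra hc
    simp only [labelAddr, Expr.val, Op.eval, hr.r5, hr.r0, hu, hx, hlu, hlx] at he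
    rw [if_pos (by omega), if_pos this] at he
    omega

/-- In each of `n` rounds, every vertex takes over the smallest label among its neighbours. -/
def propagate : Cmd :=
  .forRange 9 (.const 0) 0 (.forRange 10 (.const 0) 0
    (.seq (.assign 11 (.load (.bin .plus (.const 4) (.reg 10))))
      (.forRange 12 (.load (.bin .plus (.const 3) (.reg 10))) 11
        (.seq (.assign 13 (.load (.bin .plus (.reg 2) (.reg 12)))) relaxLabel))))

/-- After `k` rounds, the label of a vertex is at most every vertex that a walk of length at most
`k` leads to. In-place updates during a round only make labels smaller, which does no harm. The time
of a round is linear in the number of vertices and adjacency list entries; the offset of the current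
vertex serves as the potential. -/
theorem runs_propagate (hA : Room A off w S W) (hr : RegsOk n q (off n) i s.regs)
    (hm : Rep n q (off n) w b lab s.mem)
    (hl : ∀ v : Fin n, lab v = if J ⊆ A.σ v then (v : ℕ) else n) :
    Runs S W propagate s (n * (off n * 38 + n * 30 + 20) + 10) fun r μ => Agree 8 s.regs r ∧
      ∃ lab', Rep n q (off n) w b lab' μ ∧ A.IsLabelling J lab' := by
  have h1 := hA.size
  have h2 := hA.word
  have hpre : A.IsPreLabelling J lab :=
    ⟨fun v hv => by rw [hl, if_neg hv], fun v hv => ⟨v, by rw [hl, if_pos hv], .refl _⟩⟩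
  refine (Runs.forRange_const (a := 0) (b := n)
    (I := fun k r μ => r 9 = k ∧ Agree 8 s.regs r ∧ ∃ lab', Rep n q (off n) w b lab' μ ∧
      A.IsPreLabelling J lab' ∧ ∀ v : Fin n, J ⊆ A.σ v → A.Covers J lab' k v)
    (off n * 38 + n * 30 + 6) ?_ rfl (Nat.zero_le _) (by omega) ?_ ?_ ?_).mono ?_ ?_
  · simp only [Expr.Ok]; omega
  · exact ⟨by simp, (Agree.refl 8 _).update (by norm_num), lab, hm, hpre, fun v hv =>
      covers_zero (by rw [hl, if_pos hv])⟩
  · rintro k r μ ⟨hk, hag, -⟩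
    exact ⟨hk, (hr.agree hag (by norm_num)).r0⟩
  · rintro k t - hkn ⟨hk, hag, lab', hm', hl', hcov⟩
    refine (Runs.forRange (a := 0) (b := n)
      (I := fun j r μ => r 10 = j ∧ r 9 = k ∧ Agree 8 s.regs r ∧
        ∃ lab', Rep n q (off n) w b lab' μ ∧ A.IsPreLabelling J lab' ∧
        (∀ v : Fin n, J ⊆ A.σ v → A.Covers J lab' k v) ∧
        ∀ v : Fin n, J ⊆ A.σ v → (v : ℕ) < j → A.Covers J lab' (k + 1) v)
      (fun j => off j * 38 + j * 30) (fun j => (off (j + 1) - off j) * 38 + 15)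
      ?_ rfl (Nat.zero_le _) (by omega) ?_ ?_ ?_ ?_).mono ?_ ?_
    · simp only [Expr.Ok]; omega
    · intro j _ _
      have := hA.image.off_mono (Nat.le_succ j)
      simp only [Nat.succ_eq_add_one] at this
      omega
    · exact ⟨by simp, by simpa using hk, hag.update (by norm_num), lab', hm', hl', hcov, by simp⟩
    · rintro j r μ ⟨hj, hk, hag, -⟩
      exact ⟨hj, (hr.agree hag (by norm_num)).r0⟩
    · rintro j t - hjn ⟨hj, hk, hag, lab', hm', hl', hcov, hcov'⟩
      have hlo := hA.image.offset j hjn.le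
      have hhi := hA.image.offset (j + 1) hjn
      have hle := hA.image.off_mono (Nat.le_succ j)
      have hle' := hA.image.off_mono (show j + 1 ≤ n from hjn)
      simp only [Nat.succ_eq_add_one] at hle
      rw [show 3 + (j + 1) = 4 + j by ring] at hhi
      have hlo' := hm'.input (3 + j) (by omega)
      have hhi' := hm'.input (4 + j) (by omega)
      rw [hlo] at hlo'
      rw [hhi] at hhi'
      refine (Runs.seq (Runs.assign ?_ fun t' ht ht' => Runs.forRange_const
        (a := off j) (b := off (j + 1))
        (I := fun p r μ => r 12 = p ∧ r 11 = off (j + 1) ∧ r 10 = j ∧ r 9 = k ∧ Agree 8 s.regs r ∧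
          ∃ lab', Rep n q (off n) w b lab' μ ∧ A.IsPreLabelling J lab' ∧
          (∀ v : Fin n, J ⊆ A.σ v → A.Covers J lab' k v) ∧
          (∀ v : Fin n, J ⊆ A.σ v → (v : ℕ) < j → A.Covers J lab' (k + 1) v) ∧
          (J ⊆ A.σ ⟨j, hjn⟩ → ∀ p', off j ≤ p' → p' < p → ∀ x y : Fin n, w (n + 4 + p') = x →
            J ⊆ A.σ x → ∀ p : (A.restrict J).Walk x y, p.length ≤ k → lab' j ≤ y))
        30 ?_ ?_ hle (by omega) ?_ ?_ ?_)).mono ?_ ?_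
      · simp only [Expr.Ok, Expr.val, Op.eval, hj, hhi']; omega
      · simp only [Expr.Ok, Expr.val, Op.eval, ht, ht',
          Function.update_of_ne (show 10 ≠ 11 by decide), hj, hlo']
        omega
      · simp only [Expr.val, Op.eval, ht, ht', Function.update_of_ne (show 10 ≠ 11 by decide),
          hj, hlo']
      · rw [ht, ht']
        refine ⟨by simp, by simp [Expr.val, Op.eval, hj, hhi'], by simpa using hj,
          by simpa using hk,
          (hag.update (by norm_num)).update (by norm_num), lab', hm', hl', hcov, hcov', ?_⟩
        intro _ p' _ _
        omega
      · rintro p r μ ⟨hp, hb, -⟩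
        exact ⟨hp, hb⟩
      · rintro p t hlop hphi ⟨hp, hb, hj, hk, hag, lab', hm', hl', hcov, hcov', hnb⟩
        have hr' := hr.agree hag (by norm_num)
        obtain ⟨x, hx, hjx⟩ := hA.image.adj_of_nbr ⟨j, hjn⟩ p hlop hphi
        have hx' := hm'.input (n + 4 + p) (by omega)
        rw [hx] at hx'
        have hxn := x.2
        refine (Runs.seq (Runs.assign ?_ fun t' ht ht' => Runs.mono (T' := 25)
          (runs_relaxLabel hA (i := i) ?_ (ht' ▸ hm') hl' hjx ?_ ?_) le_rfl
            (Q' := fun r μ => r = Function.update t.regs 13 (x : ℕ) ∧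
              ∃ lab'', Rep n q (off n) w b lab'' μ ∧ A.IsPreLabelling J lab'' ∧
                (∀ v, lab'' v ≤ lab' v) ∧ (J ⊆ A.σ ⟨j, hjn⟩ → lab'' j ≤ lab' x)) ?_)).mono ?_ ?_
        · simp only [Expr.Ok, Expr.val, Op.eval, hr'.r2, hp, hx']; omega
        · rw [ht]
          exact hr'.agree ((Agree.refl 8 _).update (by norm_num)) (by norm_num)
        · simpa [ht] using hj
        · simp [ht, Expr.val, Op.eval, hr'.r2, hp, hx']
        · rintro r μ ⟨rfl, hh⟩
          refine ⟨?_, hh⟩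
          rw [ht]
          simp only [Expr.val, Op.eval, hr'.r2, hp, hx']
        · simp [Expr.cost]
        · rintro r μ ⟨rfl, lab'', hm'', hl'', hle, hux⟩
          refine ⟨by simpa using hp, by simp, by simpa using hb, by simpa using hj,
            by simpa using hk, (hag.update (by norm_num)).update (by norm_num), lab'', hm'', hl'',
            fun v hv => (hcov v hv).of_le (hle _), fun v hv hvj => (hcov' v hv hvj).of_le (hle _),
            fun hJ p' hp1 hp2 y z hy hyJ pw hpw => ?_⟩
          rcases Nat.lt_succ_iff_lt_or_eq.1 hp2 with hp2 | rfl
          · exact (hle _).trans (hnb hJ p' hp1 hp2 y z hy hyJ pw hpw)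
          · obtain rfl : x = y := Fin.ext (hx.symm.trans hy)
            exact (hux hJ).trans (hcov x hyJ z pw hpw)
      · simp only [Expr.cost]; omega
      · rintro r μ ⟨hp, hb, hj, hk, hag, lab', hm', hl', hcov, hcov', hnb⟩
        refine ⟨hj, by simp, by simpa using hk, hag.update (by norm_num), lab', hm', hl', hcov,
          fun v hv hvj => ?_⟩
        rcases Nat.lt_succ_iff_lt_or_eq.1 hvj with hvj | hvj
        · exact hcov' v hv hvj
        · obtain rfl : v = ⟨j, hjn⟩ := Fin.ext hvj
          refine (hcov _ hv).succ fun x y hvx pw hpw => ?_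
          obtain ⟨p', h3, h4, h5⟩ := hA.image.exists_nbr _ _ hvx.1
          exact hnb hv p' h3 h4 x y h5 hvx.2.2 pw hpw
    · simp only [hA.image.off_zero, Expr.cost]; omega
    · rintro r μ ⟨hj, hk, hag, lab', hm', hl', hcov, hcov'⟩
      exact ⟨hk, by simp, hag.update (by norm_num), lab', hm', hl', fun v hv => hcov' v hv v.2⟩
  · have : off n * 38 + n * 30 + 6 + 8 ≤ off n * 38 + n * 30 + 20 := by omega
    have := Nat.mul_le_mul_left n this
    simp only [Nat.sub_zero, Expr.cost]; omega
  · rintro r μ ⟨-, hag, lab', hm', hl', hcov⟩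
    exact ⟨hag, lab', hm', hl'.isLabelling hcov⟩

/-! ### Testing the components -/

/-- Set register `10` to `1` or `0`, according to whether the vertex in register `9` is good. -/
def testRoot : Cmd :=
  .seq (.assign 10 (.bin .equal (.load (labelAddr 9)) (.reg 9)))
    (.forRange 11 (.const 0) 6
      (.seq (.assign 12 (.load (bitAddr 11)))
        (.seq
          (.forRange 13 (.const 0) 0
            (.ite (.bin .less (itemBit 13 11) (.bin .equal (.load (labelAddr 13)) (.reg 9)))
              (.assign 12 (.const 1)) .skip))
          (.ite (.reg 12) .skip (.assign 10 (.const 0))))))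

theorem good_prefixSet_succ {ρ j : ℕ} (hj : j < q) :
    A.Good (prefixSet q b i) (j + 1) lab ρ ↔ A.Good (prefixSet q b i) j lab ρ ∧
      ((⟨j, hj⟩ : Fin q) ∈ prefixSet q b i ∨ ∃ v : Fin n, lab v = ρ ∧ ⟨j, hj⟩ ∉ A.σ v) := by
  constructor
  · refine fun h => ⟨⟨h.1, fun x hx => h.2 x (by omega)⟩, ?_⟩
    exact or_iff_not_imp_left.2 fun hc => h.2 ⟨j, hj⟩ (by simp) hc
  · rintro ⟨h, h'⟩
    refine ⟨h.1, fun x hx hxJ => ?_⟩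
    rcases Nat.lt_succ_iff_lt_or_eq.1 hx with hx | hx
    · exact h.2 x hx hxJ
    · obtain rfl : x = ⟨j, hj⟩ := Fin.ext hx
      exact h'.resolve_left hxJ

theorem runs_testRoot (hA : Room A off w S W) (hi : i ≤ q) (hb : ∀ j < q, b j ≤ 1)
    (hr : RegsOk n q (off n) i s.regs) (hm : Rep n q (off n) w b lab s.mem)
    (hl : ∀ v < n, lab v ≤ n) {ρ : ℕ} (hρ : ρ < n) (h9 : s.regs 9 = ρ) :
    Runs S W testRoot s (q * (n * 26 + 30) + 20) fun r μ => Agree 10 s.regs r ∧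
      Rep n q (off n) w b lab μ ∧ r 10 ≤ 1 ∧
      (r 10 ≠ 0 ↔ A.Good (prefixSet q b i) i lab ρ) := by
  have h1 := hA.size
  have h2 := hA.word
  have hlρ := hm.label ρ hρ
  have hlρn := hl ρ hρ
  refine (Runs.seq (Runs.assign ?_ fun t ht ht' => Runs.forRange_const (a := 0) (b := i)
    (I := fun j r μ => r 11 = j ∧ Agree 10 s.regs r ∧ Rep n q (off n) w b lab μ ∧ r 10 ≤ 1 ∧
      (r 10 ≠ 0 ↔ A.Good (prefixSet q b i) j lab ρ)) (n * 26 + 20)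
    ?_ rfl (Nat.zero_le _) (by omega) ?_ ?_ ?_)).mono ?_ ?_
  · simp only [labelAddr, Expr.Ok, Expr.val, Op.eval, hr.r5, h9, hlρ]
    refine ⟨by omega, by omega, ?_⟩
    split_ifs <;> omega
  · simp only [Expr.Ok]; omega
  · rw [ht, ht']
    refine ⟨by simp, ((Agree.refl 10 _).update (by norm_num)).update (by norm_num), hm, ?_, ?_⟩
    · simp only [labelAddr, Expr.val, Op.eval, hr.r5, h9, hlρ,
        Function.update_of_ne (show 10 ≠ 11 by decide), Function.update_self]
      split_ifs <;> omega
    · simp [labelAddr, Expr.val, Op.eval, hr.r5, h9, hlρ, Good]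
  · rintro k r μ ⟨hk, hag, -⟩
    exact ⟨hk, (hr.agree hag (by norm_num)).r6⟩
  · rintro j t - hji ⟨hj, hag, hm, h10, hg⟩
    have hjq : j < q := by omega
    have hr' := hr.agree hag (by norm_num)
    have hbit := hm.bit j hjq
    have hbj := hb j hjq
    refine Runs.mono (Q := fun r μ => r 11 = j ∧ Agree 10 s.regs r ∧ Rep n q (off n) w b lab μ ∧
        r 10 ≤ 1 ∧ (r 10 ≠ 0 ↔ A.Good (prefixSet q b i) (j + 1) lab ρ))
      (Runs.seq (Runs.assign ?_ fun t1 ht ht' => Runs.seq (T' := 4)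
      ((Runs.forRange_const (a := 0) (b := n)
        (I := fun k r μ => r 13 = k ∧ r 11 = j ∧ r 10 = t.regs 10 ∧ Agree 10 s.regs r ∧
          Rep n q (off n) w b lab μ ∧ r 12 ≤ 1 ∧
          (r 12 ≠ 0 ↔ b j ≠ 0 ∨ ∃ v : Fin n, (v : ℕ) < k ∧ lab v = ρ ∧ ⟨j, hjq⟩ ∉ A.σ v))
        18 ?_ rfl (Nat.zero_le _) (by omega) ?_ ?_ ?_).mono (T' := n * 26 + 6) ?_ ?_))) ?_ ?_
    · simp only [bitAddr, Expr.Ok, Expr.val, Op.eval, hr'.r4, hj, hbit]; omega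
    · simp only [Expr.Ok]; omega
    · rw [ht, ht']
      simp only [bitAddr, Expr.val, Op.eval, hr'.r4, hj, hbit]
      refine ⟨by simp, by simpa using hj, by simp,
        (hag.update (by norm_num)).update (by norm_num), hm, by simpa using hbj, by simp⟩
    · rintro k r μ ⟨hk, -, -, hag, -⟩
      exact ⟨hk, (hr.agree hag (by norm_num)).r0⟩
    · rintro k t2 - hkn ⟨hk, hj, h10', hag, hm, h12, hiff⟩
      have hr' := hr.agree hag (by norm_num)
      have h9' : t2.regs 9 = ρ := (hag 9 (by norm_num)).trans h9
      have hitem := hm.item hA.image hkn hjq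
      have hlk := hm.label k hkn
      have hlkn := hl k hkn
      have hidx := index_lt hkn hjq
      have hkq : k * q ≤ n * q := Nat.mul_le_mul_right q hkn.le
      have hcond : (Expr.bin .less (itemBit 13 11)
          (.bin .equal (.load (labelAddr 13)) (.reg 9))).val t2.regs t2.mem =
          if lab k = ρ ∧ (⟨j, hjq⟩ : Fin q) ∉ A.σ ⟨k, hkn⟩ then 1 else 0 := by
        simp only [itemBit, labelAddr, Expr.val, Op.eval, hr'.r3, hr'.r5, hr'.r1, hj, hk, h9',
          hitem, hlk]
        by_cases hmem : (⟨j, hjq⟩ : Fin q) ∈ A.σ ⟨k, hkn⟩ <;> by_cases h : lab k = ρ <;>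
          simp [hmem, h]
      refine (Runs.ite (T := 2) ?_ ?_ ?_).mono (by simp [itemBit, labelAddr, Expr.cost])
        fun _ _ h => h
      · simp only [itemBit, labelAddr, Expr.Ok, Expr.val, Op.eval, hr'.r3, hr'.r5, hr'.r1, hj, hk,
          h9', hitem, hlk]
        have : (if (⟨j, hjq⟩ : Fin q) ∈ A.σ ⟨k, hkn⟩ then 1 else 0) ≤ 1 := by split_ifs <;> omega
        have : (if lab k = ρ then 1 else 0) ≤ 1 := by split_ifs <;> omega
        refine ⟨by omega, by omega, ?_⟩
        split_ifs <;> omega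
      · intro hne t3 ht ht'
        rw [hcond] at hne
        simp only [ne_eq, ite_eq_right_iff, one_ne_zero, imp_false, not_not] at hne
        refine (Runs.assign ?_ ?_).mono (by simp [Expr.cost]) fun _ _ h => h
        · simp only [Expr.Ok]; omega
        · rw [ht, ht']
          refine ⟨by simpa using hk, by simp, by simpa using hj, by simpa using h10',
            (hag.update (by norm_num)).update (by norm_num), hm, by simp [Expr.val], ?_⟩
          simp only [Expr.val, ne_eq, Function.update_of_ne (show 12 ≠ 13 by decide),
            Function.update_self, one_ne_zero, not_false_eq_true, true_iff]
          exact Or.inr ⟨⟨k, hkn⟩, Nat.lt_succ_self k, hne⟩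
      · intro hne t3 ht ht'
        rw [hcond] at hne
        simp only [ite_eq_right_iff, one_ne_zero, imp_false] at hne
        refine (Runs.skip ?_).mono (by norm_num) fun _ _ h => h
        rw [ht, ht']
        refine ⟨hk, by simp, by simpa using hj, by simpa using h10',
            hag.update (by norm_num), hm, by simpa using h12, ?_⟩
        rw [Function.update_of_ne (show 12 ≠ 13 by decide), hiff]
        refine or_congr_right ⟨fun ⟨v, hv, h⟩ => ⟨v, by omega, h⟩, fun ⟨v, hv, h⟩ => ⟨v, ?_, h⟩⟩
        rcases Nat.lt_succ_iff_lt_or_eq.1 hv with hv | hv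
        · exact hv
        · obtain rfl : v = ⟨k, hkn⟩ := Fin.ext hv
          exact absurd h hne
    · simp only [Expr.cost]; omega
    · rintro r μ ⟨-, hj, h10', hag, hm, h12, hiff⟩ t2 rfl rfl
      have hstep : t2.regs 12 ≠ 0 ↔ ((⟨j, hjq⟩ : Fin q) ∈ prefixSet q b i ∨
          ∃ v : Fin n, lab v = ρ ∧ ⟨j, hjq⟩ ∉ A.σ v) := by
        rw [hiff, mem_prefixSet]
        simp [hji]
      refine (Runs.ite (T := 2) ?_ ?_ ?_).mono (by simp [Expr.cost]) fun _ _ h => h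
      · simp only [Expr.Ok]; omega
      · intro hne t3 ht ht'
        refine (Runs.skip ?_).mono (by norm_num) fun _ _ h => h
        rw [ht, ht']
        refine ⟨hj, hag, hm, by omega, ?_⟩
        rw [h10', hg, good_prefixSet_succ hjq, ← hstep]
        exact (and_iff_left hne).symm
      · intro he t3 ht ht'
        refine (Runs.assign ?_ ?_).mono (by simp [Expr.cost]) fun _ _ h => h
        · simp only [Expr.Ok]; omega
        · rw [ht, ht']
          refine ⟨by simpa using hj, hag.update (by norm_num), hm, by simp [Expr.val], ?_⟩
          rw [good_prefixSet_succ hjq, ← hstep]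
          simpa [Expr.val] using fun _ => he
    · simp only [bitAddr, Expr.cost]; omega
    · rintro r μ ⟨hj, hag, hm, h10, hg⟩
      exact ⟨hj, by simp, hag.update (by norm_num), hm, by simpa using h10, by simpa using hg⟩
  · have := Nat.mul_le_mul_right (n * 26 + 20 + 8) hi
    have h' := Nat.mul_le_mul_left q (show n * 26 + 20 + 8 ≤ n * 26 + 30 by omega)
    simp only [Nat.sub_zero, labelAddr, Expr.cost]
    omega
  · rintro r μ ⟨-, h⟩
    exact h

variable {D : ℕ}

/-! ### Visiting a prefix -/

/-- Output the set of the vertices whose label is in register `9`. -/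
def writeComponent : Cmd :=
  .seq (.forRange 11 (.const 0) 0
    (.ite (.bin .equal (.load (labelAddr 11)) (.reg 9)) (.write (.reg 11)) .skip)) .emit

theorem reaches_writeComponent (hA : Room A off w S W) (hr : RegsOk n q (off n) i s.regs)
    (hm : Rep n q (off n) w b lab s.mem) (hl : ∀ v < n, lab v ≤ n) {ρ : ℕ} (hρ : ρ < n)
    (h9 : s.regs 9 = ρ) (hbuf : s.buf = []) {δ : ℕ} (hlag : Lag D δ s)
    (hδ : δ + (17 * n + 7) ≤ D) :
    Reaches S W writeComponent s fun t => Agree 11 s.regs t.regs ∧ t.mem = s.mem ∧ t.buf = [] ∧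
      Lag D 0 t ∧ ∃ c, t.outs = s.outs ++ [(c, (List.range n).filter fun v => lab v = ρ)] := by
  have h1 := hA.size
  have h2 := hA.word
  refine Reaches.seq ((Reaches.forRange (a := 0) (b := n)
    (I := fun k t => t.regs 11 = k ∧ Agree 11 s.regs t.regs ∧ t.mem = s.mem ∧
      t.buf = ((List.range k).filter fun v => lab v = ρ) ∧ t.outs = s.outs ∧
      t.clock ≤ s.clock + 17 * k + 2)
    ?_ rfl (Nat.zero_le _) (by omega) ?_ ?_ ?_).mono ?_)
  · simp only [Expr.Ok]; omega
  · exact ⟨by simp [State.tick], (Agree.refl 11 _).update le_rfl, rfl,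
      by simpa [State.tick] using hbuf, rfl, by simp [State.tick, Expr.cost]⟩
  · rintro k t ⟨hk, hag, -⟩
    exact ⟨hk, (hr.agree hag (by norm_num)).r0⟩
  · rintro k t - hkn ⟨hk, hag, hmem, hb, ho, hc⟩
    have hr' := hr.agree hag (by norm_num)
    have h9' : t.regs 9 = ρ := (hag 9 (by norm_num)).trans h9
    have hlk := hm.label k hkn
    rw [← hmem] at hlk
    have hlkn := hl k hkn
    have hcond : (Expr.bin .equal (.load (labelAddr 11)) (.reg 9)).val (t.tick 4).regs
        (t.tick 4).mem = if lab k = ρ then 1 else 0 := by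
      simp only [State.tick, labelAddr, Expr.val, Op.eval, hr'.r5, hk, h9', hlk]
    refine Reaches.ite ?_ ?_ ?_
    · simp only [State.tick, labelAddr, Expr.Ok, Expr.val, Op.eval, hr'.r5, hk, h9', hlk]
      refine ⟨by omega, by omega, ?_⟩
      split_ifs <;> omega
    · intro hne
      rw [hcond] at hne
      have hlab : lab k = ρ := by simpa using hne
      refine ⟨_, .write (.reg 11) _ (by simp only [Expr.Fits, State.tick, hk]; omega), hk,
        by simp [State.tick], hag.update le_rfl, hmem, ?_, ho, ?_⟩
      · simp [State.tick, Expr.eval, hb, List.range_succ, hlab, hk]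
      · simp only [State.tick, labelAddr, Expr.cost]; omega
    · intro he
      rw [hcond] at he
      have hlab : lab k ≠ ρ := by simpa using he
      refine ⟨_, .skip _, hk, by simp [State.tick], hag.update le_rfl, hmem, ?_, ho, ?_⟩
      · simp [State.tick, hb, List.range_succ, hlab]
      · simp only [State.tick, labelAddr, Expr.cost]; omega
  · rintro t ⟨u, ⟨hk, hag, hmem, hb, ho, hc⟩, rfl⟩
    have hlag' : Lag D (δ + (17 * n + 6)) (u.tick 4) :=
      hlag.of_le ho (by simp only [State.tick]; omega)
    refine ⟨_, .emit _, hag, hmem, rfl, hlag'.emit (by omega) rfl rfl, u.clock + 4 + 1, ?_⟩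
    simp [State.tick, hb, ho]

theorem isListing_fiber {ρ : ℕ} :
    IsListing (fiber n lab ρ) ((List.range n).filter fun v => lab v = ρ) := by
  refine ⟨List.nodup_range.filter _, fun x => ?_⟩
  simp only [List.mem_filter, List.mem_range, decide_eq_true_eq]
  constructor
  · rintro ⟨hx, h⟩
    exact ⟨⟨x, hx⟩, mem_fiber.2 h, rfl⟩
  · rintro ⟨v, hv, rfl⟩
    exact ⟨v.2, mem_fiber.1 hv⟩

/-- Find out whether some connector has the current prefix, and put the answer into register `8`.
If the prefix is complete, output these connectors. -/
def visit : Cmd :=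
  .seq initLabels (.seq propagate (.seq (.assign 8 (.const 0))
    (.forRange 9 (.const 0) 0 (.seq testRoot
      (.ite (.reg 10)
        (.seq (.assign 8 (.const 1))
          (.ite (.bin .equal (.reg 6) (.reg 1)) writeComponent .skip))
        .skip)))))

/-- A bound for the time that one round of the last loop of `visit` takes. -/
def rootTime (n q : ℕ) : ℕ := q * (n * 26 + 30) + 17 * n + 60

/-- A bound for the time that `visit` takes, if the adjacency lists have `a` entries. -/
def visitTime (n q a : ℕ) : ℕ :=
  n * (q * 30 + 30) + n * (a * 38 + n * 30 + 20) + 40 + n * rootTime n q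

open Classical in
/-- The visit of a prefix decides whether a connector has it, and outputs the connectors with a
complete prefix. Since it takes at most `visitTime` steps, the lag grows by at most that, and is at
most that afterwards if there was an output. -/
theorem reaches_visit (hA : Room A off w S W) (hi : i ≤ q) (hb : ∀ j < q, b j ≤ 1)
    (hr : RegsOk n q (off n) i s.regs) (hm : Rep n q (off n) w b lab s.mem) (hbuf : s.buf = [])
    {δ : ℕ} (hlag : Lag D δ s) (hδ : δ + visitTime n q (off n) ≤ D) :
    Reaches S W visit s fun t => Agree 8 s.regs t.regs ∧
      (∃ lab', Rep n q (off n) w b lab' t.mem) ∧ t.buf = [] ∧ t.regs 8 ≤ 1 ∧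
      (t.regs 8 ≠ 0 ↔ ∃ X, A.IsConnector X ∧ A.HasPrefix (prefixSet q b i) i X) ∧
      Lag D (δ + visitTime n q (off n)) t ∧
      ∃ Xs O, t.outs = s.outs ++ O ∧ Xs.Nodup ∧ List.Forall₂ IsListing Xs (O.map Prod.snd) ∧
        (∀ X, X ∈ Xs ↔ i = q ∧ A.IsConnector X ∧ A.HasPrefix (prefixSet q b i) i X) ∧
        (Xs ≠ [] → Lag D (visitTime n q (off n)) t) := by
  have h1 := hA.size
  have h2 := hA.word
  refine Reaches.seq (Reaches.mono (runs_initLabels hA hi hb hr hm) ?_)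
  rintro s1 ⟨hc1, hb1, ho1, hag1, lab1, hm1, hl1⟩
  have hr1 := hr.agree hag1 (by norm_num)
  refine Reaches.seq (Reaches.mono (runs_propagate hA hr1 hm1 hl1) ?_)
  rintro s2 ⟨hc2, hb2, ho2, hag2, lab2, hm2, hl2⟩
  have hr2 := hr1.agree hag2 (by norm_num)
  have hag2' := hag1.trans hag2
  have hln : ∀ v < n, lab2 v ≤ n := fun v hv =>
    IsPreLabelling.le ⟨hl2.out, fun v hv => (hl2.mem v hv).imp fun x hx => ⟨hx.1, hx.2.1⟩⟩ ⟨v, hv⟩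
  obtain ⟨V0, hV0⟩ : ∃ V0, V0 = n * (q * 30 + 30) + n * (off n * 38 + n * 30 + 20) + 30 := ⟨_, rfl⟩
  obtain ⟨R, hR⟩ : ∃ R, R = rootTime n q := ⟨_, rfl⟩
  have hV : visitTime n q (off n) = V0 + 10 + n * R := by rw [hV0, hR]; rfl
  rw [hV] at hδ ⊢
  set J := prefixSet q b i with hJ
  have hJi : ∀ j ∈ J, (j : ℕ) < i := fun j hj => (mem_prefixSet.1 hj).1
  refine Reaches.seq (Reaches.mono (Runs.assign (Q := fun r μ => Agree 8 s.regs r ∧ r 8 = 0 ∧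
    μ = s2.mem) ?_ ?_) ?_)
  · simp only [Expr.Ok]; omega
  · exact ⟨hag2'.update le_rfl, by simp [Expr.val], rfl⟩
  rintro s3 ⟨hc3, hb3, ho3, hag3, h8, hm3⟩
  rw [← hm3] at hm2
  simp only [Expr.cost] at hc3
  have hr3 := hr.agree hag3 (by norm_num)
  refine Reaches.mono (Reaches.forRange (a := 0) (b := n)
    (I := fun k t => t.regs 9 = k ∧ Agree 8 s.regs t.regs ∧ Rep n q (off n) w b lab2 t.mem ∧
      t.buf = [] ∧ t.regs 8 ≤ 1 ∧ (t.regs 8 ≠ 0 ↔ ∃ ρ < k, A.Good J i lab2 ρ) ∧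
      Lag D (δ + V0 + k * R) t ∧ ∃ O, t.outs = s.outs ++ O ∧
        List.Forall₂ IsListing (if i = q then
          ((List.range k).filter fun ρ => A.Good J i lab2 ρ).map (fiber n lab2) else [])
          (O.map Prod.snd) ∧ (O ≠ [] → Lag D (V0 + k * R) t)) ?_ rfl (Nat.zero_le _) (by omega)
    ?_ ?_ ?_) ?_
  · simp only [Expr.Ok]; omega
  · refine ⟨by simp [State.tick], hag3.update (by norm_num), hm2, ?_, ?_, ?_, ?_, [], ?_, ?_, ?_⟩
    · rw [← hbuf, ← hb1, ← hb2, ← hb3]; rfl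
    · simp [State.tick, h8]
    · simp [State.tick, h8]
    · refine hlag.of_le ?_ ?_
      · rw [← ho1, ← ho2, ← ho3]; rfl
      · simp only [State.tick, Expr.cost]; omega
    · rw [← ho1, ← ho2, ← ho3]; simp [State.tick]
    · simp
    · simp
  · rintro k t ⟨hk, hag, -⟩
    exact ⟨hk, (hr.agree hag (by norm_num)).r0⟩
  · rintro k t - hkn ⟨hk, hag, hm, hb', h8', hiff, hlagk, O, hO, hF, hO'⟩
    have hr' := hr.agree hag (by norm_num)
    have hkR : k * R + R ≤ n * R := by
      have := Nat.mul_le_mul_right R (show k + 1 ≤ n from hkn)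
      rwa [add_mul, one_mul] at this
    have hRv : R = q * (n * 26 + 30) + 17 * n + 60 := hR
    have hk1 : (k + 1) * R = k * R + R := by ring
    rw [hk1]
    refine Reaches.seq (Reaches.mono (runs_testRoot (s := t.tick 4) hA hi hb hr' hm hln hkn hk) ?_)
    rintro t1 ⟨hc4, hb4, ho4, hag4, hm4, h10, hg⟩
    have hag4' := hag.trans (hag4.mono (show 8 ≤ 10 by norm_num))
    have hr4 := hr.agree hag4' (by norm_num)
    have h94 : t1.regs 9 = k := (hag4 9 (by norm_num)).trans hk
    have h84 : t1.regs 8 = t.regs 8 := hag4 8 (by norm_num)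
    simp only [State.tick] at hc4 hb4 ho4
    rw [← hJ] at hg
    refine Reaches.ite ?_ ?_ ?_
    · simp only [Expr.Ok]; omega
    · intro hne
      have hgood := hg.1 hne
      have hiff' : ∃ ρ < k + 1, A.Good J i lab2 ρ := ⟨k, Nat.lt_succ_self k, hgood⟩
      refine Reaches.seq (Reaches.mono (Runs.assign (Q := fun r μ => Agree 8 s.regs r ∧ r 8 = 1 ∧
        r 9 = k ∧ μ = t1.mem) ?_ ?_) ?_)
      · simp only [Expr.Ok]; omega
      · exact ⟨hag4'.update le_rfl, by simp [Expr.val], by simpa [State.tick] using h94, rfl⟩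
      rintro t2 ⟨hc5, hb5, ho5, hag5, h85, h95, hm5⟩
      rw [← hm5] at hm4
      have hr5 := hr.agree hag5 (by norm_num)
      simp only [State.tick, Expr.cost] at hc5 hb5 ho5
      refine Reaches.ite ?_ ?_ ?_
      · simp only [Expr.Ok, Expr.val, Op.eval, hr5.r6, hr5.r1]
        split_ifs <;> omega
      · intro hiq
        have hiq : i = q := by
          simpa [Expr.val, Op.eval, hr5.r6, hr5.r1] using hiq
        have hlagw : Lag D (δ + V0 + k * R + R - (17 * n + 20)) (t2.tick 4) := by
          refine hlagk.of_le ?_ ?_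
          · rw [← ho4, ← ho5]; rfl
          · simp only [State.tick]; omega
        refine (reaches_writeComponent (s := t2.tick 4) hA hr5 hm4 hln hkn h95 ?_ hlagw
          (by omega)).mono ?_
        · rw [← hb', ← hb4, ← hb5]; rfl
        rintro t3 ⟨hag6, hm6, hb6, hlag6, c, ho6⟩
        have h86 : t3.regs 8 = 1 := (hag6 8 (by norm_num)).trans h85
        have hlagt : Lag D (V0 + (k * R + R))
            ({ t3 with regs := Function.update t3.regs 9 (k + 1) }.tick 4) :=
          hlag6.of_le rfl (by simp only [State.tick]; omega)
        refine ⟨(hag6 9 (by norm_num)).trans h95, by simp [State.tick],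
          (hag5.trans (hag6.mono (by norm_num))).update (by norm_num), ?_, hb6, ?_, ?_, ?_,
          O ++ [(c, (List.range n).filter fun v => lab2 v = k)], ?_, ?_, fun _ => hlagt⟩
        · change Rep n q (off n) w b lab2 t3.mem
          rw [hm6]
          exact hm4
        · simp [State.tick, h86]
        · simpa [State.tick, h86] using hiff'
        · exact hlagt.of_le rfl (by omega)
        · rw [← List.append_assoc, ← hO, ← ho4, ← ho5]
          exact ho6
        · rw [if_pos hiq] at hF ⊢
          rw [List.range_succ, List.filter_append, List.map_append, List.map_append]
          refine List.rel_append hF ?_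
          simp only [List.filter_singleton, hgood, decide_true, cond_true, List.map_cons,
            List.map_nil, List.forall₂_cons, List.Forall₂.nil, and_true]
          exact isListing_fiber
      · intro hiq
        have hiq : i ≠ q := by
          simpa [Expr.val, Op.eval, hr5.r6, hr5.r1] using hiq
        refine ⟨_, .skip _, by simpa [State.tick] using h95, by simp [State.tick],
          hag5.update (by norm_num), hm4, ?_, ?_, ?_, ?_, O, ?_, ?_, fun hne => ?_⟩
        · rw [← hb', ← hb4, ← hb5]; rfl
        · simp [State.tick, h85]
        · simpa [State.tick, h85] using hiff'
        · refine hlagk.of_le ?_ ?_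
          · rw [← ho4, ← ho5]; rfl
          · simp only [State.tick, Expr.cost]; omega
        · rw [← hO, ← ho4, ← ho5]; rfl
        · rw [if_neg hiq] at hF ⊢
          exact hF
        · refine (hO' hne).of_le ?_ ?_
          · rw [← ho4, ← ho5]; rfl
          · simp only [State.tick, Expr.cost]; omega
    · intro he
      have hbad : ¬ A.Good J i lab2 k := fun h => hg.2 h he
      refine ⟨_, .skip _, by simpa [State.tick] using h94, by simp [State.tick],
        hag4'.update (by norm_num), hm4, ?_, ?_, ?_, ?_, O, ?_, ?_, fun hne => ?_⟩
      · rw [← hb', ← hb4]; rfl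
      · simpa [State.tick, h84] using h8'
      · simp only [State.tick, Function.update_of_ne (show 8 ≠ 9 by decide), h84, hiff]
        refine ⟨fun ⟨ρ, hρ, h⟩ => ⟨ρ, by omega, h⟩, fun ⟨ρ, hρ, h⟩ => ⟨ρ, ?_, h⟩⟩
        rcases Nat.lt_succ_iff_lt_or_eq.1 hρ with hρ | rfl
        · exact hρ
        · exact absurd h hbad
      · refine hlagk.of_le ?_ ?_
        · rw [← ho4]; rfl
        · simp only [State.tick, Expr.cost]; omega
      · rw [← hO, ← ho4]; rfl
      · simpa [List.range_succ, hbad] using hF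
      · refine (hO' hne).of_le ?_ ?_
        · rw [← ho4]; rfl
        · simp only [State.tick, Expr.cost]; omega
  · rintro t ⟨u, ⟨-, hag, hm, hb', h8', hiff, hlagk, O, hO, hF, hO'⟩, rfl⟩
    refine ⟨hag, ⟨lab2, hm⟩, hb', h8', hiff.trans (hl2.exists_isConnector_iff hJi), ?_, _, O,
      hO, ?_, hF, fun X => ?_, fun hne => ?_⟩
    · exact hlagk.of_le rfl (by simp only [State.tick]; omega)
    · split_ifs
      · refine List.Nodup.map_on (fun x hx y hy hxy => ?_) (List.nodup_range.filter _)
        simp only [List.mem_filter, List.mem_range, decide_eq_true_eq] at hx hy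
        have : (⟨x, hx.1⟩ : Fin n) ∈ fiber n lab2 y := hxy ▸ mem_fiber.2 hx.2.1
        exact hx.2.1.symm.trans (mem_fiber.1 this)
      · exact List.nodup_nil
    · split_ifs with hiq
      · rw [hiq, hl2.isConnector_iff]
        simp only [List.mem_map, List.mem_filter, List.mem_range, decide_eq_true_eq, true_and,
          and_assoc]
      · simp [hiq]
    · refine (hO' fun h => hne ?_).of_le rfl (by simp only [State.tick]; omega)
      rw [h] at hF
      simpa using hF

variable {b' : ℕ → ℕ} {t u : State}

/-! ### The search through the prefixes -/

/-- After the visit of a prefix: append a `0` to it if there is a connector below it and it is not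
complete, and otherwise turn back. -/
def descend : Cmd :=
  .ite (.bin .times (.reg 8) (.bin .less (.reg 6) (.reg 1)))
    (.seq (.store (bitAddr 6) (.const 0)) (.incr 6)) (.assign 7 (.const 2))

/-- When the subtree of a prefix has been searched: stop if the prefix is empty, replace its last
bit by `1` and search again if that bit is `0`, and remove that bit otherwise. -/
def ascend : Cmd :=
  .ite (.reg 6)
    (.seq (.assign 6 (.bin .minus (.reg 6) (.const 1)))
      (.ite (.load (bitAddr 6)) .skip
        (.seq (.store (bitAddr 6) (.const 1)) (.seq (.incr 6) (.assign 7 (.const 1))))))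
    (.assign 7 (.const 0))

/-- One step of the search. Register `7` is `1` when the current prefix is still to be visited, `2`
when its subtree has been searched, and `0` at the end. -/
def searchStep : Cmd :=
  .ite (.bin .equal (.reg 7) (.const 1)) (.seq visit descend) ascend

/-- The depth-first search through the tree of all prefixes. -/
def search : Cmd := .loop (.reg 7) searchStep

/-- The state `s` stands before a step of the search: the current prefix consists of the first `i`
bits of `b`, and register `7` contains `p`. -/
structure At (n q a i p : ℕ) (w b : ℕ → ℕ) (s : State) : Prop where
  regs : RegsOk n q a i s.regs
  mode : s.regs 7 = p
  mem : ∃ lab, Rep n q a w b lab s.mem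
  buf : s.buf = []

/-- The search, started in `s`, comes through `t`. -/
def Leads (S W : ℕ) (s t : State) : Prop := ∀ u, Exec S W search t u → Exec S W search s u

theorem Leads.trans (h : Leads S W s t) (h' : Leads S W t u) : Leads S W s u :=
  fun v hv => h v (h' v hv)

theorem RegsOk.update_six {x : ℕ} (h : RegsOk n q a i r) :
    RegsOk n q a x (Function.update r 6 x) :=
  ⟨by simpa using h.r0, by simpa using h.r1, by simpa using h.r2, by simpa using h.r3,
    by simpa using h.r4, by simpa using h.r5, by simp⟩

theorem RegsOk.update {x k : ℕ} (h : RegsOk n q a i r) (hk : 7 ≤ k) :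
    RegsOk n q a i (Function.update r k x) :=
  h.agree ((Agree.refl 7 r).update hk) le_rfl

/-- A bound for the time of one step of the search. -/
def stepTime (n q a : ℕ) : ℕ := visitTime n q a + 50

theorem leads_of_reaches {p : ℕ} {P : State → Prop} (hs : s.regs 7 = p) (hp : p ≠ 0) (hW : p < W)
    (h : Reaches S W searchStep (s.tick 2) P) : ∃ t, Leads S W s t ∧ P t := by
  obtain ⟨t, ht, hP⟩ := h
  exact ⟨t, fun u hu => .loop_true (by simpa [Expr.Fits, hs] using hW)
    (by simpa [Expr.eval, hs] using hp) ht hu, hP⟩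

/-- A step that visits a prefix: the search goes down if a connector has the prefix and the prefix
is not complete, and turns back otherwise. -/
theorem leads_visit (hA : Room A off w S W) (hi : i ≤ q) (hb : ∀ j < q, b j ≤ 1)
    (hs : At n q (off n) i 1 w b s) {δ : ℕ} (hlag : Lag D δ s)
    (hδ : δ + stepTime n q (off n) ≤ D) :
    ∃ t, Leads S W s t ∧ Lag D (δ + stepTime n q (off n)) t ∧
      ((∃ X, A.IsConnector X ∧ A.HasPrefix (prefixSet q b i) i X) ∧ i < q →
        At n q (off n) (i + 1) 1 w (Function.update b i 0) t) ∧
      (¬ ((∃ X, A.IsConnector X ∧ A.HasPrefix (prefixSet q b i) i X) ∧ i < q) →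
        At n q (off n) i 2 w b t) ∧
      ∃ Xs O, t.outs = s.outs ++ O ∧ Xs.Nodup ∧ List.Forall₂ IsListing Xs (O.map Prod.snd) ∧
        (∀ X, X ∈ Xs ↔ i = q ∧ A.IsConnector X ∧ A.HasPrefix (prefixSet q b i) i X) ∧
        (Xs ≠ [] → Lag D (stepTime n q (off n)) t) := by
  have h1 := hA.size
  have h2 := hA.word
  obtain ⟨lab, hm⟩ := hs.mem
  obtain ⟨V, hV⟩ : ∃ V, V = visitTime n q (off n) := ⟨_, rfl⟩
  have hT : stepTime n q (off n) = V + 50 := by rw [hV]; rfl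
  rw [hT] at hδ ⊢
  refine leads_of_reaches hs.mode one_ne_zero (by omega) (Reaches.ite ?_ ?_ ?_)
  · simp only [State.tick, Expr.Ok, Expr.val, Op.eval, hs.mode]
    refine ⟨by omega, by omega, ?_⟩
    split_ifs <;> omega
  swap
  · intro he
    simp [State.tick, Expr.val, Op.eval, hs.mode] at he
  intro _
  have hlag0 : Lag D (δ + 6) ((s.tick 2).tick 4) :=
    hlag.of_le rfl (by simp only [State.tick]; omega)
  have hvis := reaches_visit (s := (s.tick 2).tick 4) hA hi hb hs.regs hm hs.buf hlag0
    (by rw [← hV]; omega)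
  rw [← hV] at hvis
  refine Reaches.seq (hvis.mono ?_)
  rintro t ⟨hag, ⟨lab', hm'⟩, hbuf, h8, hiff, hlagt, Xs, O, hO, hnd, hF, hX, hXs⟩
  have hr := hs.regs.agree hag (by norm_num)
  have h7 : t.regs 7 = 1 := (hag 7 (by norm_num)).trans hs.mode
  have hval : (Expr.bin .times (.reg 8) (.bin .less (.reg 6) (.reg 1))).val t.regs t.mem ≠ 0 ↔
      (∃ X, A.IsConnector X ∧ A.HasPrefix (prefixSet q b i) i X) ∧ i < q := by
    rw [← hiff]
    simp [Expr.val, Op.eval, hr.r6, hr.r1, and_comm]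
  refine Reaches.ite ?_ ?_ ?_
  · simp only [Expr.Ok, Expr.val, Op.eval, hr.r6, hr.r1]
    refine ⟨by omega, ⟨by omega, by omega, ?_⟩, ?_⟩ <;> split_ifs <;> omega
  · intro hne
    have hc := hval.1 hne
    have hiq := hc.2
    refine Reaches.mono (Runs.seq (T := 5) (T' := 4)
      (Q := fun r μ => r = Function.update t.regs 6 (i + 1) ∧
        μ = Function.update t.mem (n + 4 + off n + n * q + i) 0)
      (Runs.mono (Runs.store (Q := fun r μ => r = t.regs ∧
        μ = Function.update t.mem (n + 4 + off n + n * q + i) 0) ?_ ?_ ?_ ?_) ?_ ?_)) ?_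
    · simp only [State.tick, bitAddr, Expr.Ok, Expr.val, Op.eval, hr.r6, hr.r4]
      omega
    · simp only [Expr.Ok]; omega
    · simp only [State.tick, bitAddr, Expr.val, Op.eval, hr.r6, hr.r4]
      omega
    · simp only [State.tick, bitAddr, Expr.val, Op.eval, hr.r6, hr.r4, and_self]
    · simp only [bitAddr, Expr.cost]; omega
    · rintro r μ ⟨rfl, rfl⟩ t' ht ht'
      refine Runs.assign ?_ ⟨?_, ht'⟩
      · simp only [Expr.Ok, Expr.val, Op.eval, ht, hr.r6]; omega
      · simp only [Expr.val, Op.eval, ht, hr.r6]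
    · rintro u ⟨hcu, hbu, hou, hru, hmu⟩
      have hlagu : Lag D (δ + (V + 50)) u ∧ (Xs ≠ [] → Lag D (V + 50) u) := by
        simp only [State.tick, Expr.cost] at hcu hou
        exact ⟨hlagt.of_le hou (by omega), fun h => (hXs h).of_le hou (by omega)⟩
      refine ⟨hlagu.1, fun _ => ⟨?_, ?_, ⟨lab', ?_⟩, hbu.trans hbuf⟩, fun h => absurd hc h, Xs, O,
        hou.trans hO, hnd, hF, hX, hlagu.2⟩
      · rw [hru]; exact hr.update_six
      · rw [hru]; simpa using h7
      · rw [hmu]; exact hm'.store_bit hiq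
  · intro he
    have hc := fun h => hval.2 h he
    refine Reaches.mono (Runs.assign (Q := fun r μ => r = Function.update t.regs 7 2 ∧ μ = t.mem)
      ?_ ⟨rfl, rfl⟩) ?_
    · simp only [Expr.Ok]; omega
    · rintro u ⟨hcu, hbu, hou, hru, hmu⟩
      have hlagu : Lag D (δ + (V + 50)) u ∧ (Xs ≠ [] → Lag D (V + 50) u) := by
        simp only [State.tick, Expr.cost] at hcu hou
        exact ⟨hlagt.of_le hou (by omega), fun h => (hXs h).of_le hou (by omega)⟩
      refine ⟨hlagu.1, fun h => absurd h hc, fun _ => ⟨?_, ?_, ⟨lab', ?_⟩, hbu.trans hbuf⟩, Xs, O,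
        hou.trans hO, hnd, hF, hX, hlagu.2⟩
      · rw [hru]; exact hr.update le_rfl
      · rw [hru]; simp
      · rw [hmu]; exact hm'

/-- A step of the search that does not visit a prefix produces no output. -/
theorem leads_of_ascend {P : (ℕ → ℕ) → (ℕ → ℕ) → Prop} (hA : Room A off w S W)
    (hs : At n q (off n) i 2 w b s)
    (h : ∀ t : State, t.regs = s.regs → t.mem = s.mem → Runs S W ascend t 30 P) :
    ∃ t, Leads S W s t ∧ (∀ δ, Lag D δ s → Lag D (δ + stepTime n q (off n)) t) ∧
      t.outs = s.outs ∧ t.buf = [] ∧ P t.regs t.mem := by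
  have h1 := hA.size
  have h2 := hA.word
  refine leads_of_reaches hs.mode two_ne_zero (by omega) (Reaches.ite ?_ ?_ ?_)
  · simp only [State.tick, Expr.Ok, Expr.val, Op.eval, hs.mode]
    refine ⟨by omega, by omega, ?_⟩
    split_ifs <;> omega
  · intro he
    simp [State.tick, Expr.val, Op.eval, hs.mode] at he
  · intro _
    refine Reaches.mono (h _ rfl rfl) ?_
    rintro t ⟨hc, hb, ho, hP⟩
    refine ⟨fun δ hδ => hδ.of_le ho ?_, ho, hb.trans hs.buf, hP⟩
    simp only [State.tick, Expr.cost] at hc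
    simp only [stepTime]
    omega

/-- When both subtrees have been searched, the prefix loses its last bit. -/
theorem leads_pop (hA : Room A off w S W) (hi : i < q) (hbi : b i = 1)
    (hs : At n q (off n) (i + 1) 2 w b s) :
    ∃ t, Leads S W s t ∧ (∀ δ, Lag D δ s → Lag D (δ + stepTime n q (off n)) t) ∧
      t.outs = s.outs ∧ At n q (off n) i 2 w b t := by
  have h1 := hA.size
  have h2 := hA.word
  obtain ⟨lab, hm⟩ := hs.mem
  have hbit := hm.bit i hi
  have hr := hs.regs.update_six (x := i)
  have key : ∀ t : State, t.regs = s.regs → t.mem = s.mem → Runs S W ascend t 30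
      (fun r μ => r = Function.update s.regs 6 i ∧ μ = s.mem) := by
    intro t ht ht'
    refine (Runs.ite (T := 11) ?_ ?_ ?_).mono (by simp [Expr.cost]) fun _ _ h => h
    · simp only [Expr.Ok, ht, hs.regs.r6]; omega
    · intro _ t1 ht1 ht1'
      refine (Runs.seq (T' := 7) (Runs.assign ?_ ?_)).mono (by simp [Expr.cost]) fun _ _ h => h
      · simp only [Expr.Ok, Expr.val, Op.eval, ht1, ht, hs.regs.r6]; omega
      · intro t2 ht2 ht2'
        have ht2 : t2.regs = Function.update s.regs 6 i := by
          simp [ht2, ht1, ht, Expr.val, Op.eval, hs.regs.r6]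
        have ht2' : t2.mem = s.mem := ht2'.trans (ht1'.trans ht')
        rw [← ht2] at hr
        refine (Runs.ite (T := 1) ?_ ?_ ?_).mono (by simp [bitAddr, Expr.cost]) fun _ _ h => h
        · simp only [bitAddr, Expr.Ok, Expr.val, Op.eval, hr.r4, hr.r6, ht2', hbit]; omega
        · exact fun _ t3 ht3 ht3' => Runs.skip ⟨ht3.trans ht2, ht3'.trans ht2'⟩
        · intro he
          simp only [bitAddr, Expr.val, Op.eval, hr.r4, hr.r6, ht2', hbit] at he
          omega
    · intro he
      simp only [Expr.val, ht, hs.regs.r6] at he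
      omega
  obtain ⟨t, h3, h4, h5, h6, h7, h8⟩ := leads_of_ascend (D := D) hA hs key
  refine ⟨t, h3, h4, h5, ?_, ?_, ⟨lab, ?_⟩, h6⟩
  · rw [h7]; exact hr
  · rw [h7]; simpa using hs.mode
  · rw [h8]; exact hm

/-- When the subtree of the last bit `0` has been searched, that of the bit `1` follows. -/
theorem leads_flip (hA : Room A off w S W) (hi : i < q) (hbi : b i = 0)
    (hs : At n q (off n) (i + 1) 2 w b s) :
    ∃ t, Leads S W s t ∧ (∀ δ, Lag D δ s → Lag D (δ + stepTime n q (off n)) t) ∧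
      t.outs = s.outs ∧ At n q (off n) (i + 1) 1 w (Function.update b i 1) t := by
  have h1 := hA.size
  have h2 := hA.word
  obtain ⟨lab, hm⟩ := hs.mem
  have hbit := hm.bit i hi
  have hr := hs.regs.update_six (x := i)
  have key : ∀ t : State, t.regs = s.regs → t.mem = s.mem → Runs S W ascend t 30
      (fun r μ => (RegsOk n q (off n) (i + 1) r ∧ r 7 = 1) ∧
      μ = Function.update s.mem (n + 4 + off n + n * q + i) 1) := by
    intro t ht ht'
    refine (Runs.ite (T := 28) ?_ ?_ ?_).mono (by simp [Expr.cost]) fun _ _ h => h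
    · simp only [Expr.Ok, ht, hs.regs.r6]; omega
    · intro _ t1 ht1 ht1'
      refine (Runs.seq (T' := 24) (Runs.assign ?_ ?_)).mono (by simp [Expr.cost]) fun _ _ h => h
      · simp only [Expr.Ok, Expr.val, Op.eval, ht1, ht, hs.regs.r6]; omega
      · intro t2 ht2 ht2'
        have ht2 : t2.regs = Function.update s.regs 6 i := by
          simp [ht2, ht1, ht, Expr.val, Op.eval, hs.regs.r6]
        have ht2' : t2.mem = s.mem := ht2'.trans (ht1'.trans ht')
        rw [← ht2] at hr
        refine (Runs.ite (T := 11) ?_ ?_ ?_).mono (by simp [bitAddr, Expr.cost]) fun _ _ h => h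
        · simp only [bitAddr, Expr.Ok, Expr.val, Op.eval, hr.r4, hr.r6, ht2', hbit]; omega
        · intro hne
          simp only [bitAddr, Expr.val, Op.eval, hr.r4, hr.r6, ht2', hbit] at hne
          omega
        · intro _ t3 ht3 ht3'
          rw [← ht3] at hr
          refine (Runs.seq (T' := 6) (Runs.store ?_ ?_ ?_ ?_)).mono (by simp [bitAddr, Expr.cost])
            fun _ _ h => h
          · simp only [bitAddr, Expr.Ok, Expr.val, Op.eval, hr.r4, hr.r6]; omega
          · simp only [Expr.Ok]; omega
          · simp only [bitAddr, Expr.val, Op.eval, hr.r4, hr.r6]; omega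
          · intro t4 ht4 ht4'
            simp only [bitAddr, Expr.val, Op.eval, hr.r4, hr.r6, ht3', ht2'] at ht4'
            rw [← ht4] at hr
            refine (Runs.seq (T := 4) (T' := 2) (Runs.assign ?_ ?_)).mono (by simp) fun _ _ h => h
            · simp only [Expr.Ok, Expr.val, Op.eval, hr.r6]; omega
            · intro t5 ht5 ht5'
              refine (Runs.assign ?_ ⟨⟨?_, by simp [Expr.val]⟩, ht5'.trans ht4'⟩).mono
                (by simp [Expr.cost]) fun _ _ h => h
              · simp only [Expr.Ok]; omega
              · refine RegsOk.update ?_ le_rfl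
                rw [ht5]
                simp only [Expr.val, Op.eval, hr.r6]
                exact hr.update_six
    · intro he
      simp only [Expr.val, ht, hs.regs.r6] at he
      omega
  obtain ⟨t, h3, h4, h5, h6, h7, h8⟩ := leads_of_ascend (D := D) hA hs key
  refine ⟨t, h3, h4, h5, h7.1, h7.2, ⟨lab, ?_⟩, h6⟩
  rw [h8]; exact hm.store_bit hi

theorem leads_stop (hA : Room A off w S W) (hs : At n q (off n) 0 2 w b s) :
    ∃ t, Leads S W s t ∧ (∀ δ, Lag D δ s → Lag D (δ + stepTime n q (off n)) t) ∧
      t.outs = s.outs ∧ t.buf = [] ∧ t.regs 7 = 0 := by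
  have h1 := hA.size
  have h2 := hA.word
  refine leads_of_ascend (P := fun r _ => r 7 = 0) hA hs fun t ht _ => ?_
  refine (Runs.ite (T := 2) ?_ ?_ ?_).mono (by simp [Expr.cost]) fun _ _ h => h
  · simp only [Expr.Ok, ht, hs.regs.r6]; omega
  · intro hne
    simp [Expr.val, ht, hs.regs.r6] at hne
  · intro _ t1 _ _
    exact Runs.assign (by simp only [Expr.Ok]; omega) (by simp [Expr.val])

/-- The prefix of length `i + 1` fixes the membership of one more item, that of the item `i`. -/
theorem hasPrefix_succ_iff (hi : i < q) (hbb : ∀ j < i, b' j = b j) {X : Finset (Fin n)} :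
    A.HasPrefix (prefixSet q b' (i + 1)) (i + 1) X ↔
      A.HasPrefix (prefixSet q b i) i X ∧ (⟨i, hi⟩ ∈ A.commonItems X ↔ b' i ≠ 0) := by
  simp only [HasPrefix, mem_prefixSet]
  constructor
  · refine fun h => ⟨fun j hj => ?_, ?_⟩
    · rw [h j (by omega), hbb j hj]
      simp only [hj, Nat.lt_succ_of_lt hj]
    · rw [h ⟨i, hi⟩ (by simp)]
      simp
  · rintro ⟨h, h'⟩ j hj
    rcases Nat.lt_succ_iff_lt_or_eq.1 hj with hj' | hj'
    · rw [h j hj', hbb j hj']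
      simp only [hj, hj']
    · obtain rfl : j = ⟨i, hi⟩ := Fin.ext hj'
      rw [h']
      simp

/-- The search of the subtree of a prefix of length `i = q - k` outputs the connectors with this
prefix. If there are any, it makes at most `3 * k + 1` steps before the first and after the last of
them: each level adds the visit of the prefix itself, the visit of a child without connectors, and
the steps from the one child to the other or back to the prefix. If there are none, the search of
the subtree consists of one step. -/
theorem leads_subtree (hA : Room A off w S W) (hD : (6 * q + 10) * stepTime n q (off n) ≤ D)
    (k : ℕ) :
    ∀ (i : ℕ) (b : ℕ → ℕ) (s : State) (δ : ℕ), i + k = q → (∀ j < q, b j ≤ 1) →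
      At n q (off n) i 1 w b s → Lag D δ s → δ + (3 * k + 1) * stepTime n q (off n) ≤ D →
      ∃ t b', Leads S W s t ∧ At n q (off n) i 2 w b' t ∧ (∀ j < i, b' j = b j) ∧
        (∀ j < q, b' j ≤ 1) ∧
        ∃ Xs O, t.outs = s.outs ++ O ∧ Xs.Nodup ∧ List.Forall₂ IsListing Xs (O.map Prod.snd) ∧
          (∀ X, X ∈ Xs ↔ A.IsConnector X ∧ A.HasPrefix (prefixSet q b i) i X) ∧
          (Xs = [] → Lag D (δ + stepTime n q (off n)) t) ∧
          (Xs ≠ [] → Lag D ((3 * k + 1) * stepTime n q (off n)) t) := by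
  obtain ⟨T, hT⟩ : ∃ T, T = stepTime n q (off n) := ⟨_, rfl⟩
  induction k with
  | zero =>
    intro i b s δ hik hb hs hlag hδ
    obtain ⟨t, h1, h2, -, h3, Xs, O, hO, hnd, hF, hX, hXs⟩ :=
      leads_visit hA (by omega) hb hs hlag (by simpa using hδ)
    refine ⟨t, b, h1, h3 (by omega), fun _ _ => rfl, hb, Xs, O, hO, hnd, hF, fun X => ?_,
      fun _ => h2, fun hne => by simpa using hXs hne⟩
    rw [hX]
    exact and_iff_right (by omega)
  | succ k ih =>
    intro i b s δ hik hb hs hlag hδ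
    have hiq : i < q := by omega
    rw [← hT] at hD hδ ih ⊢
    have hTk : (3 * (k + 1) + 1) * T = (3 * k + 1) * T + 3 * T := by ring
    have hTD : 2 * ((3 * k + 1) * T) + 6 * T ≤ D := by
      refine le_trans ?_ hD
      have : (2 * (3 * k + 1) + 6) * T ≤ (6 * q + 10) * T := Nat.mul_le_mul_right T (by omega)
      refine le_trans (le_of_eq ?_) this
      ring
    rw [hTk] at hδ ⊢
    obtain ⟨t1, h1, h2, h3, h4, Ys, P, hP, -, hFP, hY, -⟩ :=
      leads_visit hA hiq.le hb hs hlag (by rw [← hT]; omega)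
    rw [← hT] at h2
    obtain rfl : Ys = [] := List.eq_nil_iff_forall_not_mem.2 fun X hX => by
      have := ((hY X).1 hX).1
      omega
    obtain rfl : P = [] := by simpa using hFP
    rw [List.append_nil] at hP
    by_cases hc : ∃ X, A.IsConnector X ∧ A.HasPrefix (prefixSet q b i) i X
    swap
    · refine ⟨t1, b, h1, h4 fun h => hc h.1, fun _ _ => rfl, hb, [], [], by simpa using hP,
        List.nodup_nil, .nil, fun X => ?_, fun _ => h2, fun h => absurd rfl h⟩
      simp only [List.not_mem_nil, false_iff]
      exact fun h => hc ⟨X, h⟩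
    -- the child with a `0`
    obtain ⟨t2, b2, g1, g2, g3, g4, Xs, O, hO, hnd, hF, hX, hX0, hX1⟩ :=
      ih (i + 1) (Function.update b i 0) t1 (δ + T) (by omega) (fun j hj => by
        by_cases hji : j = i
        · rw [hji, Function.update_self]; omega
        · rw [Function.update_of_ne hji]; exact hb j hj) (h3 ⟨hc, hiq⟩) h2 (by omega)
    have hb2 : b2 i = 0 := by rw [g3 i (Nat.lt_succ_self i), Function.update_self]
    have hb2' : ∀ j < i, b2 j = b j := fun j hj => by
      rw [g3 j (by omega), Function.update_of_ne (by omega)]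
    obtain ⟨t3, k1, k2, k3, k4⟩ := leads_flip (D := D) hA hiq hb2 g2
    rw [← hT] at k2
    -- the lag after the first child: it starts anew if that child produced output
    obtain ⟨ε, hε, hεD, hlag3⟩ : ∃ ε, (Xs ≠ [] → ε ≤ (3 * k + 1) * T + T) ∧
        ε + (3 * k + 1) * T ≤ D ∧ Lag D ε t3 := by
      by_cases hXn : Xs = []
      · exact ⟨δ + T + T + T, fun h => absurd hXn h, by omega, k2 _ (hX0 hXn)⟩
      · exact ⟨(3 * k + 1) * T + T, fun _ => le_rfl, by omega, k2 _ (hX1 hXn)⟩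
    -- the child with a `1`
    obtain ⟨t4, b4, l1, l2, l3, l4, Zs, P, hP', hnd', hF', hZ, hZ0, hZ1⟩ :=
      ih (i + 1) (Function.update b2 i 1) t3 ε (by omega) (fun j hj => by
        by_cases hji : j = i
        · rw [hji, Function.update_self]
        · rw [Function.update_of_ne hji]; exact g4 j hj) k4 hlag3 hεD
    have hb4 : b4 i = 1 := by rw [l3 i (Nat.lt_succ_self i), Function.update_self]
    have hb4' : ∀ j < i, b4 j = b j := fun j hj => by
      rw [l3 j (by omega), Function.update_of_ne (by omega), hb2' j hj]
    obtain ⟨t5, m1, m2, m3, m4⟩ := leads_pop (D := D) hA hiq hb4 l2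
    rw [← hT] at m2
    have hX' : ∀ X, X ∈ Xs ↔ A.IsConnector X ∧ A.HasPrefix (prefixSet q b i) i X ∧
        ⟨i, hiq⟩ ∉ A.commonItems X := fun X => by
      rw [hX, hasPrefix_succ_iff hiq (b := b) fun j hj => Function.update_of_ne (by omega) _ _]
      simp
    have hZ' : ∀ X, X ∈ Zs ↔ A.IsConnector X ∧ A.HasPrefix (prefixSet q b i) i X ∧
        ⟨i, hiq⟩ ∈ A.commonItems X := fun X => by
      rw [hZ, hasPrefix_succ_iff hiq (b := b) fun j hj => by
        rw [Function.update_of_ne (by omega), hb2' j hj]]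
      simp
    have hall : ∀ X, X ∈ Xs ++ Zs ↔ A.IsConnector X ∧ A.HasPrefix (prefixSet q b i) i X :=
      fun X => by
        rw [List.mem_append, hX', hZ']
        by_cases hi : ⟨i, hiq⟩ ∈ A.commonItems X <;> simp [hi]
    refine ⟨t5, b4, (((h1.trans g1).trans k1).trans l1).trans m1, m4, hb4', l4, Xs ++ Zs, O ++ P,
      ?_, ?_, ?_, hall, fun h => ?_, fun h => ?_⟩
    · rw [m3, hP', k3, hO, hP, List.append_assoc]
    · refine List.nodup_append.2 ⟨hnd, hnd', ?_⟩
      rintro X hXX Y hYY rfl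
      exact ((hX' X).1 hXX).2.2 ((hZ' X).1 hYY).2.2
    · rw [List.map_append]
      exact List.rel_append hF hF'
    · obtain ⟨X, hXc⟩ := hc
      have := (hall X).2 hXc
      rw [h] at this
      simp at this
    · by_cases hZn : Zs = []
      · have hXn : Xs ≠ [] := fun hXn => h (by rw [hXn, hZn]; rfl)
        have := hε hXn
        exact (m2 _ (hZ0 hZn)).of_le rfl (by omega)
      · exact (m2 _ (hZ1 hZn)).of_le rfl (by omega)

/-! ### The whole program -/

/-- Compute the addresses of the parts of the memory. -/
def setup : Cmd :=
  .seq (.assign 0 (.load (.const 0))) (.seq (.assign 1 (.load (.const 2)))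
    (.seq (.assign 2 (.bin .plus (.reg 0) (.const 4)))
      (.seq (.assign 3 (.bin .plus (.reg 2) (.load (.bin .plus (.reg 0) (.const 3)))))
        (.seq (.assign 4 (.bin .plus (.reg 3) (.bin .times (.reg 0) (.reg 1))))
          (.seq (.assign 5 (.bin .plus (.reg 4) (.reg 1))) (.assign 7 (.const 1)))))))

theorem runs_setup (hA : Room A off w S W) (hs : s.regs = fun _ => 0) (hm : s.mem = w) :
    Runs S W setup s 50 fun r μ => RegsOk n q (off n) 0 r ∧ r 7 = 1 ∧ μ = w := by
  have h1 := hA.size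
  have h2 := hA.word
  have w0 := hA.image.vertices
  have w2 := hA.image.items
  have w3 := hA.image.offset n le_rfl
  rw [add_comm] at w3
  refine Runs.mono (T := 3 + 38) (Runs.seq (Runs.assign ?_ fun t1 e1 f1 => ?_)) (by norm_num)
    fun _ _ h => h
  · simp only [Expr.Ok, Expr.val, hm, w0]; omega
  · simp only [Expr.val, hs, hm, w0] at e1 f1
    refine Runs.mono (T := 3 + 35) (Runs.seq (Runs.assign ?_ fun t2 e2 f2 => ?_)) le_rfl
      fun _ _ h => h
    · simp only [Expr.Ok, Expr.val, f1, w2]; omega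
    rw [f1] at f2
    simp only [Expr.val, e1, f1, w2] at e2
    have a0 : t2.regs 0 = n := by simp [e2]
    have a1 : t2.regs 1 = q := by simp [e2]
    have a6 : t2.regs 6 = 0 := by simp [e2]
    refine Runs.mono (T := 4 + 31) (Runs.seq (Runs.assign ?_ fun t3 e3 f3 => ?_)) le_rfl
      fun _ _ h => h
    · simp only [Expr.Ok, Expr.val, Op.eval, a0]; omega
    rw [f2] at f3
    simp only [Expr.val, Op.eval, a0] at e3
    have b0 : t3.regs 0 = n := by simp [e3, a0]
    have b1 : t3.regs 1 = q := by simp [e3, a1]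
    have b2 : t3.regs 2 = n + 4 := by simp [e3]
    have b6 : t3.regs 6 = 0 := by simp [e3, a6]
    refine Runs.mono (T := 7 + 24) (Runs.seq (Runs.assign ?_ fun t4 e4 f4 => ?_)) le_rfl
      fun _ _ h => h
    · simp only [Expr.Ok, Expr.val, Op.eval, b0, b2, f3, w3]; omega
    rw [f3] at f4
    simp only [Expr.val, Op.eval, b0, b2, f3, w3] at e4
    have c0 : t4.regs 0 = n := by simp [e4, b0]
    have c1 : t4.regs 1 = q := by simp [e4, b1]
    have c2 : t4.regs 2 = n + 4 := by simp [e4, b2]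
    have c3 : t4.regs 3 = n + 4 + off n := by simp [e4]
    have c6 : t4.regs 6 = 0 := by simp [e4, b6]
    refine Runs.mono (T := 6 + 18) (Runs.seq (Runs.assign ?_ fun t5 e5 f5 => ?_)) le_rfl
      fun _ _ h => h
    · simp only [Expr.Ok, Expr.val, Op.eval, c0, c1, c3]; omega
    rw [f4] at f5
    simp only [Expr.val, Op.eval, c0, c1, c3] at e5
    have d1 : t5.regs 1 = q := by simp [e5, c1]
    have d4 : t5.regs 4 = n + 4 + off n + n * q := by simp [e5]
    refine Runs.mono (T := 4 + 2) (Runs.seq (Runs.assign ?_ fun t6 e6 f6 => ?_)) (by norm_num)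
      fun _ _ h => h
    · simp only [Expr.Ok, Expr.val, Op.eval, d1, d4]; omega
    simp only [Expr.val, Op.eval, d1, d4] at e6
    refine Runs.assign ?_ ⟨RegsOk.update ?_ le_rfl, by simp [Expr.val], f6.trans f5⟩
    · simp only [Expr.Ok]; omega
    · rw [e6, e5]
      exact ⟨by simp [c0], by simp [c1], by simp [c2], by simp [c3], by simp, by simp,
        by simp [c6]⟩

/-- The enumeration algorithm. -/
def enumerate : Cmd := .seq setup search

theorem exec_enumerate (hA : Room A off w S W) (hD : (6 * q + 10) * stepTime n q (off n) ≤ D)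
    (hs : s.regs = fun _ => 0) (hm : s.mem = w) (hbuf : s.buf = []) (houts : s.outs = [])
    (hlag : Lag D 0 s) (hw : ∀ x, n + 4 + off n + n * q ≤ x → w x = 0) :
    ∃ t, Exec S W enumerate s t ∧ Enumerates A.IsConnector t ∧ DelayAtMost D t := by
  have h1 := hA.size
  have h2 := hA.word
  obtain ⟨t1, e1, hc1, hb1, ho1, hr1, h71, hm1⟩ := runs_setup hA hs hm
  obtain ⟨T, hT⟩ : ∃ T, T = stepTime n q (off n) := ⟨_, rfl⟩
  have hT50 : 50 ≤ T := by rw [hT]; exact Nat.le_add_left _ _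
  have hTD : 2 * ((3 * q + 1) * T) + 8 * T ≤ D := by
    refine le_trans (le_of_eq ?_) hD
    rw [← hT]
    ring
  have hat : At n q (off n) 0 1 w (fun _ => 0) t1 := by
    refine ⟨hr1, h71, ⟨fun _ => 0, ?_, ?_, ?_⟩, hb1.trans hbuf⟩
    · intro x _
      rw [hm1]
    · intro x _
      rw [hm1, hw _ (by omega)]
    · intro x _
      rw [hm1, hw _ (by omega)]
  have hlag1 : Lag D 50 t1 := hlag.of_le ho1 (by omega)
  obtain ⟨t2, b2, g1, g2, -, -, Xs, O, hO, hnd, hF, hX, hX0, hX1⟩ :=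
    leads_subtree hA hD q 0 _ t1 50 (Nat.zero_add q) (fun _ _ => Nat.zero_le _) hat hlag1
      (by rw [← hT]; omega)
  obtain ⟨t3, k1, k2, k3, k4, k5⟩ := leads_stop (D := D) hA g2
  rw [← hT] at hX0 hX1 k2
  have hend : Exec S W search t3 (t3.tick 2) := .loop_false (by simp only [Expr.Fits, k5]; omega) k5
  have hlag3 : Lag D (2 * ((3 * q + 1) * T) + 7 * T) t3 := by
    by_cases hXn : Xs = []
    · exact (k2 _ (hX0 hXn)).of_le rfl (by omega)
    · exact (k2 _ (hX1 hXn)).of_le rfl (by omega)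
  have hlag4 : Lag D D (t3.tick 2) := hlag3.of_le rfl (by simp only [State.tick]; omega)
  refine ⟨t3.tick 2, .seq e1 (g1 _ (k1 _ hend)), ⟨k4, Xs, hnd, fun X => ?_, ?_⟩,
    hlag4.delayAtMost le_rfl⟩
  · rw [hX]
    exact and_iff_left fun j hj => absurd hj (Nat.not_lt_zero _)
  · have : (t3.tick 2).outs = O := by
      rw [show (t3.tick 2).outs = t3.outs from rfl, k3, hO, ho1, houts, List.nil_append]
    rw [this]
    exact hF

/-! ### The bounds -/

theorem stepTime_le {a : ℕ} (hn : 1 ≤ n) (hq : 1 ≤ q) (ha : a ≤ 2 * m) :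
    stepTime n q a ≤ 450 * (q * ((n + m) * n)) := by
  have e1 : stepTime n q a = 26 * (q * (n * n)) + 60 * (n * q) + 38 * (n * a) + 47 * (n * n) +
      110 * n + 90 := by
    simp only [stepTime, visitTime, rootTime]; ring
  have e2 : q * ((n + m) * n) = q * (n * n) + q * (n * m) := by ring
  have f1 : n ≤ n * n := Nat.le_mul_self n
  have f2 : n * n ≤ q * (n * n) := Nat.le_mul_of_pos_left _ hq
  have f3 : n * q ≤ q * (n * n) := by rw [mul_comm]; exact Nat.mul_le_mul_left q f1
  have f4 : n * a ≤ 2 * (q * (n * m)) :=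
    calc n * a ≤ n * (2 * m) := Nat.mul_le_mul_left n ha
      _ = 2 * (n * m) := by ring
      _ ≤ 2 * (q * (n * m)) := Nat.mul_le_mul_left 2 (Nat.le_mul_of_pos_left _ hq)
  omega

theorem size_le {a : ℕ} (hn : 1 ≤ n) (hq : 1 ≤ q) (ha : a ≤ 2 * m) :
    n + 4 + a + n * q + q + n ≤ 7200 * ((q + n + m) * n) := by
  have e1 : (q + n + m) * n = n * q + n * n + n * m := by ring
  have f1 : n ≤ n * n := Nat.le_mul_self n
  have f2 : q ≤ n * q := Nat.le_mul_of_pos_left _ hn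
  have f3 : m ≤ n * m := Nat.le_mul_of_pos_left _ hn
  omega

/-- As `n + m + q ≥ 2`, a high power of it exceeds the constant as well. -/
theorem size_lt_word (hn : 1 ≤ n) (hq : 1 ≤ q) : 7200 * ((q + n + m) * n) < (n + m + q) ^ 16 := by
  have h2 : 2 ≤ n + m + q := by omega
  have f1 : 2 ^ 14 ≤ (n + m + q) ^ 14 := Nat.pow_le_pow_left h2 14
  have f2 : (q + n + m) * n ≤ (n + m + q) * (n + m + q) := Nat.mul_le_mul (by omega) (by omega)
  have f3 : 0 < (n + m + q) * (n + m + q) := by positivity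
  calc 7200 * ((q + n + m) * n) ≤ 7200 * ((n + m + q) * (n + m + q)) := Nat.mul_le_mul_left _ f2
    _ < 2 ^ 14 * ((n + m + q) * (n + m + q)) := Nat.mul_lt_mul_of_pos_right (by norm_num) f3
    _ ≤ (n + m + q) ^ 14 * ((n + m + q) * (n + m + q)) := Nat.mul_le_mul_right _ f1
    _ = (n + m + q) ^ 16 := by ring

end ConnectorEnum

/-- One program enumerates the connectors of every instance, with `O(q ^ 2 * (n + m) * n)` delay,
in a memory of `O((q + n + m) * n)` words (which holds the input too) of `O(log (n + m + q))` bits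
each. -/
theorem theorem2 :
    ∃ (prog : ConnectorEnum.Cmd) (C c : ℕ),
      ∀ (n m q : ℕ), 1 ≤ n → 1 ≤ q →
      ∀ (A : ConnectorEnum.Instance n m q) (adj : Fin n → List (Fin n)), A.IsAdjacencyList adj →
        (A.inputWords adj).length ≤ C * ((q + n + m) * n) ∧
        ∃ t : ConnectorEnum.State,
          ConnectorEnum.Exec (C * ((q + n + m) * n)) ((n + m + q) ^ c) prog
            (ConnectorEnum.initialState (A.inputWords adj)) t ∧
          ConnectorEnum.Enumerates A.IsConnector t ∧
          ConnectorEnum.DelayAtMost (C * (q ^ 2 * (n + m) * n)) t := by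
  refine ⟨ConnectorEnum.enumerate, 7200, 16, fun n m q hn hq A adj hadj => ?_⟩
  have hsize := ConnectorEnum.size_le hn hq hadj.offset_le
  have hlen := ConnectorEnum.Instance.length_inputWords (A := A) adj
  refine ⟨by omega, ConnectorEnum.exec_enumerate
    ⟨ConnectorEnum.Instance.isImage_inputWords hadj, hsize, ConnectorEnum.size_lt_word hn hq⟩
    ?_ rfl rfl rfl rfl (ConnectorEnum.lag_initialState _ _) ?_⟩
  -- a gap between two outputs comprises at most `6 * q + 10 ≤ 16 * q` steps of the search
  · calc (6 * q + 10) * ConnectorEnum.stepTime n q _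
        ≤ (16 * q) * (450 * (q * ((n + m) * n))) :=
          Nat.mul_le_mul (by omega) (ConnectorEnum.stepTime_le hn hq hadj.offset_le)
      _ = 7200 * (q ^ 2 * (n + m) * n) := by ring
  · intro x hx
    exact List.getD_eq_default _ _ (by omega)
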